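/- Let $m\ge 1$ and let $F_m=\det^{-1}(1)$ be the global Milnor fiber of the determinant on the space of complex $m\times m$ matrices; as a closed subspace of the matrix space it is $SL_m(\mathbb C)$. For a unit vector $x\in\mathbb C^m$ and $\theta\in\mathbb R$ let $A_{(\theta,x)}=I_m-(1-e^{i\theta})\,x\bar x^{T}$. For $1\le r\le m$ let $$E_r=(0,1)\times\{x=(x_1,\dots,x_r,0,\dots,0)\in\mathbb C^m:\ \|x\|=1,\ x_r\in\mathbb R,\ x_r>0\}.$$ A Schubert symbol is a (possibly empty) sequence $\mathbf m=(m_1,\dots,m_k)$ of integers with $1<m_1<\dots<m_k\le m$. Put $E_{\mathbf m}=E_{m_1}\times\cdots\times E_{m_k}$, let $$\psi_{\mathbf m}\big((t_1,x_1),\dots,(t_k,x_k)\big)=A_{(-2\pi\sum_j t_j,\;e_1)}\,A_{(2\pi t_1,x_1)}\cdots A_{(2\pi t_k,x_k)},$$ and let the Schubert cell of $SU_m$ with symbol $\mathbf m$ be $S_{\mathbf m}=\psi_{\mathbf m}(E_{\mathbf m})$. Let $Sol_m=A_mN_m$, where $A_m$ is the group of diagonal matrices of determinant $1$ with positive real diagonal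 entries and $N_m$ is the group of upper triangular complex matrices with $1$'s on the diagonal. Then the sets $S_{\mathbf m}\cdot Sol_m$, where $\mathbf m$ ranges over all Schubert symbols, form a cell decomposition of $F_m$. That is: 1. $F_m$ is the disjoint union of the sets $S_{\mathbf m}\cdot Sol_m$, and $S_{\mathbf m}\subset SU_m$ for every $\mathbf m$. 2. For every $\mathbf m$, the map $E_{\mathbf m}\times Sol_m\to S_{\mathbf m}\cdot Sol_m$, $(p,C)\mapsto\psi_{\mathbf m}(p)\,C$, is a homeomorphism, and $S_{\mathbf m}\cdot Sol_m$ is homeomorphic to $\mathbb R^{d(\mathbf m)}$, where $d(\mathbf m)=\sum_{j=1}^k(2m_j-1)+2\binom m2+m-1$. 3. For every $\mathbf m$, the set $\overline{S_{\mathbf m}\cdot Sol_m}\setminus (S_{\mathbf m}\cdot Sol_m)$ is contained in the union of the cells $S_{\mathbf m'}\cdot Sol_m$ with $d(\mathbf m')<d(\mathbf m)$. -/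

import Mathlib

open scoped Matrix Pointwise

noncomputable section

/-- The global Milnor fiber `f⁻¹(1)` of `f = det` on the space of all `m × m` complex matrices. -/
def globalMilnorFiber (m : ℕ) : Set (Matrix (Fin m) (Fin m) ℂ) :=
  Matrix.det ⁻¹' {1}

/-- The pseudo-rotation `A_(θ, x) = I - (1 - e^{iθ}) x x̄ᵀ` about the hyperplane `x^⊥`, for a
unit column vector `x`. -/
def pseudoRotation {n : ℕ} (θ : ℝ) (x : EuclideanSpace ℂ (Fin n)) :
    Matrix (Fin n) (Fin n) ℂ :=
  1 - (1 - Complex.exp (θ * Complex.I)) • Matrix.vecMulVec x.ofLp (star x.ofLp)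

/-- The first standard basis vector `e₁` of `ℂⁿ` (the coordinate `x_{j+1}` of the usual numbering
from `1` is the one with index `j : Fin n`). -/
def firstBasisVector (n : ℕ) : EuclideanSpace ℂ (Fin n) :=
  WithLp.toLp 2 fun j => if j.val = 0 then 1 else 0

/-- A Schubert symbol `(m_1, …, m_k)` with `1 < m_1 < … < m_k ≤ n`; the empty symbol `k = 0` is
allowed. -/
structure SchubertSymbol (n : ℕ) where
  /-- the length `k` -/
  length : ℕ
  /-- the entries `m_1, …, m_k` -/
  entry : Fin length → ℕ
  strictMono : StrictMono entry
  one_lt : ∀ i, 1 < entry i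
  le : ∀ i, entry i ≤ n

/-- The open cell `E_r = (0, 1) × {x = (x_1, …, x_r, 0, …, 0) : ‖x‖ = 1, x_r real and x_r > 0}`,
as a set of pairs in `ℝ × ℂⁿ`. -/
def simpleCell (n r : ℕ) : Set (ℝ × EuclideanSpace ℂ (Fin n)) :=
  {p | (0 < p.1 ∧ p.1 < 1) ∧ ‖p.2‖ = 1 ∧ (∀ j : Fin n, r ≤ j.val → p.2 j = 0) ∧
    ∃ j : Fin n, j.val + 1 = r ∧ (p.2 j).im = 0 ∧ 0 < (p.2 j).re}

namespace SchubertSymbol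

variable {n : ℕ}

/-- The product cell `E_{m_1} × ⋯ × E_{m_k}`. -/
def paramCell (s : SchubertSymbol n) : Set (Fin s.length → ℝ × EuclideanSpace ℂ (Fin n)) :=
  Set.univ.pi fun i => simpleCell n (s.entry i)

/-- The map `ψ ((t_1, x_1), …, (t_k, x_k)) =
A_(-2π(t_1 + ⋯ + t_k), e₁) · A_(2π t_1, x_1) ⋯ A_(2π t_k, x_k)` (in this order). -/
def psi (s : SchubertSymbol n) (p : Fin s.length → ℝ × EuclideanSpace ℂ (Fin n)) :
    Matrix (Fin n) (Fin n) ℂ :=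
  pseudoRotation (-2 * Real.pi * ∑ i, (p i).1) (firstBasisVector n) *
    (List.ofFn fun i => pseudoRotation (2 * Real.pi * (p i).1) (p i).2).prod

/-- The Schubert cell of `SU_n` with the given symbol: the image of the product cell under `ψ`. -/
def schubertCell (s : SchubertSymbol n) : Set (Matrix (Fin n) (Fin n) ℂ) :=
  s.psi '' s.paramCell

/-- The real dimension `∑ (2 m_i - 1)` of the Schubert cell of `SU_n` (each `m_i` is at
least `2`). -/
def dim (s : SchubertSymbol n) : ℕ :=
  ∑ i, (2 * s.entry i - 1)

end SchubertSymbol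

/-- `A_m`: diagonal matrices of determinant `1` with positive real diagonal entries. -/
def iwasawaA (m : ℕ) : Set (Matrix (Fin m) (Fin m) ℂ) :=
  {M | (∃ d : Fin m → ℝ, (∀ i, 0 < d i) ∧ M = Matrix.diagonal fun i => (d i : ℂ)) ∧ M.det = 1}

/-- `N_m`: upper triangular complex matrices with `1`s on the diagonal. -/
def iwasawaN (m : ℕ) : Set (Matrix (Fin m) (Fin m) ℂ) :=
  {M | (∀ i j, j < i → M i j = 0) ∧ ∀ i, M i i = 1}

/-- `Sol_m = A_m · N_m`, the product set. -/
def iwasawaSol (m : ℕ) : Set (Matrix (Fin m) (Fin m) ℂ) :=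
  iwasawaA m * iwasawaN m

/-- The Schubert cell `S_𝐦 · Sol_m` of the global Milnor fiber, the set of all products. -/
def milnorSchubertCell {m : ℕ} (s : SchubertSymbol m) : Set (Matrix (Fin m) (Fin m) ℂ) :=
  s.schubertCell * iwasawaSol m

/-- The real dimension of `S_𝐦 · Sol_m`: that of `S_𝐦` plus `dim Sol_m = 2 (m choose 2) + m - 1`
(used for `m ≥ 1` only). -/
def milnorCellDim {m : ℕ} (s : SchubertSymbol m) : ℕ :=
  s.dim + (2 * m.choose 2 + (m - 1))

end

/-!
The proof rests on three facts.

*Factors can be split off one at a time.* Let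
`ψ(p) = A_(-2π ∑ t_i, e₁) A_(2πt_1, x_1) ⋯ A_(2πt_k, x_k)` with
symbol `m_1 < ⋯ < m_k`. All factors but the last fix the basis vector of index `j = m_k`, so
the `j`-th row of `ψ(p)` is the `j`-th row of `A_(2πt_k, x_k)`. The parameter `(t_k, x_k)` is an
explicit continuous function `recoverParam` of this row, and every unit row supported in the first
`j` coordinates, other than that of the identity, arises from a unique parameter. Dividing by the
last factor (and correcting the determinant by a rotation about `e₁`) gives a product of `k - 1`
factors. Hence by induction `ψ` is an embedding of the product cell
(`SchubertSymbol.isEmbedding_psi`), and, by induction over the subgroups `SU_r`, every special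
unitary matrix lies in some Schubert cell (`exists_mem_schubertCell`).

*The symbol is encoded in ranks.* For `r ≥ 1` the rows of `U - 1` beyond the `r`-th form a matrix of
rank `#{i | m_i > r}` when `U` lies in the cell with symbol `(m_1, …, m_k)`
(`SchubertSymbol.rank_lowerDefect`). These numbers determine the symbol, so the cells are disjoint.
Rank is lower semicontinuous, so none of them increases on passing to a point of the closure; as the
dimension `∑ (2 m_i - 1)` of a cell is a strictly increasing function of these numbers, a point of
the closure outside the cell lies in a cell of smaller dimension. No attaching maps are needed.

*The Iwasawa decomposition is a homeomorphism.* Multiplication `SU_m × Sol_m → SL_m` is injective,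
and it is a closed map because `SU_m` is compact and `Sol_m` closed
(`isClosedEmbedding_iwasawaMul`); it is onto by the Gram-Schmidt process. Thus all statements about
the cells `S · Sol_m` reduce to statements about the cells of `SU_m`. That a cell is a Euclidean
space is seen in logarithmic coordinates on `Sol_m` and by central projection of the hemispheres.
-/

noncomputable section

/-! ### Pseudo-rotations -/

section PseudoRotation

variable {n : ℕ}

lemma pseudoRotation_apply (θ : ℝ) (x : EuclideanSpace ℂ (Fin n)) (i j : Fin n) :
    pseudoRotation θ x i j =
      (1 : Matrix (Fin n) (Fin n) ℂ) i j - (1 - Complex.exp (θ * Complex.I)) * (x i * star (x j)) := by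
  simp [pseudoRotation, Matrix.vecMulVec_apply]

lemma continuous_pseudoRotation :
    Continuous fun p : ℝ × EuclideanSpace ℂ (Fin n) => pseudoRotation p.1 p.2 := by
  refine continuous_matrix fun i j => ?_
  simp only [pseudoRotation_apply]
  fun_prop

lemma star_dotProduct_self_of_norm_eq_one {x : EuclideanSpace ℂ (Fin n)} (hx : ‖x‖ = 1) :
    star x.ofLp ⬝ᵥ x.ofLp = 1 := by
  have h := inner_self_eq_norm_sq_to_K (𝕜 := ℂ) x
  rw [hx, EuclideanSpace.inner_eq_star_dotProduct, dotProduct_comm] at h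
  simpa using h

@[simp]
lemma pseudoRotation_zero (x : EuclideanSpace ℂ (Fin n)) : pseudoRotation 0 x = 1 := by
  simp [pseudoRotation]

lemma pseudoRotation_add {x : EuclideanSpace ℂ (Fin n)} (hx : ‖x‖ = 1) (a b : ℝ) :
    pseudoRotation (a + b) x = pseudoRotation a x * pseudoRotation b x := by
  have h := star_dotProduct_self_of_norm_eq_one hx
  have hP : Matrix.vecMulVec x.ofLp (star x.ofLp) * Matrix.vecMulVec x.ofLp (star x.ofLp) =
      Matrix.vecMulVec x.ofLp (star x.ofLp) := by
    rw [Matrix.vecMulVec_mul_vecMulVec, h, one_smul]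
  simp only [pseudoRotation, sub_mul, mul_sub, one_mul, mul_one, smul_mul_assoc, mul_smul_comm, hP,
    Complex.ofReal_add, add_mul, Complex.exp_add]
  module

lemma pseudoRotation_mul_neg {x : EuclideanSpace ℂ (Fin n)} (hx : ‖x‖ = 1) (a : ℝ) :
    pseudoRotation a x * pseudoRotation (-a) x = 1 := by
  rw [← pseudoRotation_add hx, add_neg_cancel, pseudoRotation_zero]

lemma pseudoRotation_neg_mul {x : EuclideanSpace ℂ (Fin n)} (hx : ‖x‖ = 1) (a : ℝ) :
    pseudoRotation (-a) x * pseudoRotation a x = 1 := by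
  rw [← pseudoRotation_add hx, neg_add_cancel, pseudoRotation_zero]

lemma star_pseudoRotation (θ : ℝ) (x : EuclideanSpace ℂ (Fin n)) :
    star (pseudoRotation θ x) = pseudoRotation (-θ) x := by
  ext i j
  rw [Matrix.star_apply, pseudoRotation_apply, pseudoRotation_apply]
  have h : star (Complex.exp (θ * Complex.I)) = Complex.exp ((-θ : ℝ) * Complex.I) := by
    rw [Complex.star_def, ← Complex.exp_conj]
    simp
  rw [star_sub, star_mul', star_sub, h, star_mul', star_star, star_one, Matrix.one_apply,
    Matrix.one_apply, mul_comm (star (x j))]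
  simp [apply_ite, eq_comm]

lemma det_pseudoRotation (θ : ℝ) {x : EuclideanSpace ℂ (Fin n)} (hx : ‖x‖ = 1) :
    (pseudoRotation θ x).det = Complex.exp (θ * Complex.I) := by
  have h := star_dotProduct_self_of_norm_eq_one hx
  have : pseudoRotation θ x = 1 + Matrix.replicateCol Unit
      (-(1 - Complex.exp (θ * Complex.I)) • x.ofLp) * Matrix.replicateRow Unit (star x.ofLp) := by
    ext i j
    simp [pseudoRotation_apply, Matrix.mul_apply]
    ring
  rw [this, Matrix.det_one_add_replicateCol_mul_replicateRow, dotProduct_smul, h]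
  simp

lemma pseudoRotation_mem_unitaryGroup (θ : ℝ) {x : EuclideanSpace ℂ (Fin n)} (hx : ‖x‖ = 1) :
    pseudoRotation θ x ∈ Matrix.unitaryGroup (Fin n) ℂ := by
  rw [Matrix.mem_unitaryGroup_iff, star_pseudoRotation, pseudoRotation_mul_neg hx]

/-- The hyperplane orthogonal to the axis is fixed: a row with vanishing axis coordinate is a row
of the identity. -/
lemma pseudoRotation_row_of_eq_zero (θ : ℝ) {x : EuclideanSpace ℂ (Fin n)} {j : Fin n}
    (hj : x j = 0) : pseudoRotation θ x j = Pi.single j 1 := by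
  ext i
  rw [pseudoRotation_apply, hj, Matrix.one_apply, Pi.single_apply]
  simp [eq_comm]

lemma norm_firstBasisVector (hn : 1 ≤ n) : ‖firstBasisVector n‖ = 1 := by
  have : firstBasisVector n = EuclideanSpace.single (⟨0, hn⟩ : Fin n) (1 : ℂ) := by
    ext j
    simp [firstBasisVector, Fin.ext_iff]
  rw [this]
  simp

lemma firstBasisVector_apply_of_pos {j : Fin n} (hj : 1 ≤ j.val) : firstBasisVector n j = 0 := by
  simp [firstBasisVector]
  omega

/-- If the `j`-th row of `M` is that of the identity, then left multiplication by `M` leaves the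
`j`-th row unchanged. -/
lemma mul_row_of_row_eq_single {M : Matrix (Fin n) (Fin n) ℂ} {j : Fin n}
    (h : M j = Pi.single j 1) (N : Matrix (Fin n) (Fin n) ℂ) : (M * N) j = N j := by
  rw [Matrix.mul_apply_eq_vecMul, h, Matrix.single_one_vecMul]
  rfl

end PseudoRotation

/-! ### Products of pseudo-rotations -/

section RotationProduct

variable {n k : ℕ}

/-- The map `ψ` of the Schubert cells, for a tuple of parameters of arbitrary length `k`, not yet
restricted to a product of cells. -/
def rotationProduct (p : Fin k → ℝ × EuclideanSpace ℂ (Fin n)) : Matrix (Fin n) (Fin n) ℂ :=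
  pseudoRotation (-2 * Real.pi * ∑ i, (p i).1) (firstBasisVector n) *
    (List.ofFn fun i => pseudoRotation (2 * Real.pi * (p i).1) (p i).2).prod

lemma rotationProduct_zero (p : Fin 0 → ℝ × EuclideanSpace ℂ (Fin n)) : rotationProduct p = 1 := by
  simp [rotationProduct]

/-- The last factor can be split off, together with its share of the correction about `e₁`. -/
lemma rotationProduct_succ (hn : 1 ≤ n) (p : Fin (k + 1) → ℝ × EuclideanSpace ℂ (Fin n)) :
    rotationProduct p = pseudoRotation (-(2 * Real.pi * (p (Fin.last k)).1)) (firstBasisVector n) *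
      rotationProduct (Fin.init p) *
      pseudoRotation (2 * Real.pi * (p (Fin.last k)).1) (p (Fin.last k)).2 := by
  have h : -2 * Real.pi * ∑ i, (p i).1 = -(2 * Real.pi * (p (Fin.last k)).1) +
      -2 * Real.pi * ∑ i, (Fin.init p i).1 := by
    rw [Fin.sum_univ_castSucc]
    simp only [Fin.init]
    ring
  rw [rotationProduct, h, pseudoRotation_add (norm_firstBasisVector hn), List.ofFn_succ',
    List.concat_eq_append, List.prod_append, rotationProduct]
  simp [mul_assoc, Fin.init]

lemma continuous_rotationProduct :
    Continuous fun p : Fin k → ℝ × EuclideanSpace ℂ (Fin n) => rotationProduct p := by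
  unfold rotationProduct
  refine Continuous.mul ?_ ?_
  · exact continuous_pseudoRotation.comp
      (f := fun p : Fin k → ℝ × EuclideanSpace ℂ (Fin n) =>
        ((-2 * Real.pi * ∑ i, (p i).1 : ℝ), firstBasisVector n)) (by fun_prop)
  · simp only [List.ofFn_eq_map]
    refine continuous_list_prod _ fun i _ => ?_
    exact continuous_pseudoRotation.comp
      (f := fun p : Fin k → ℝ × EuclideanSpace ℂ (Fin n) => ((2 * Real.pi * (p i).1 : ℝ), (p i).2))
      (by fun_prop)

lemma rotationProduct_mem_specialUnitaryGroup (hn : 1 ≤ n) :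
    ∀ {k : ℕ} {p : Fin k → ℝ × EuclideanSpace ℂ (Fin n)}, (∀ i, ‖(p i).2‖ = 1) →
      rotationProduct p ∈ Matrix.specialUnitaryGroup (Fin n) ℂ
  | 0, p, _ => by
    rw [rotationProduct_zero]
    exact one_mem _
  | k + 1, p, hp => by
    have ih := rotationProduct_mem_specialUnitaryGroup hn (p := Fin.init p)
      fun i => hp (Fin.castSucc i)
    rw [Matrix.mem_specialUnitaryGroup_iff] at ih ⊢
    rw [rotationProduct_succ hn]
    refine ⟨mul_mem (mul_mem (pseudoRotation_mem_unitaryGroup _ (norm_firstBasisVector hn)) ih.1)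
      (pseudoRotation_mem_unitaryGroup _ (hp _)), ?_⟩
    rw [Matrix.det_mul, Matrix.det_mul, ih.2, det_pseudoRotation _ (hp _),
      det_pseudoRotation _ (norm_firstBasisVector hn), mul_one, ← Complex.exp_add]
    simp

lemma norm_of_mem_simpleCell {r : ℕ} {q : ℝ × EuclideanSpace ℂ (Fin n)}
    (hq : q ∈ simpleCell n r) : ‖q.2‖ = 1 := hq.2.1

lemma pseudoRotation_row_of_mem_simpleCell {r : ℕ} {q : ℝ × EuclideanSpace ℂ (Fin n)}
    (hq : q ∈ simpleCell n r) {j : Fin n} (hj : r ≤ j.val) (θ : ℝ) :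
    pseudoRotation θ q.2 j = Pi.single j 1 :=
  pseudoRotation_row_of_eq_zero θ (hq.2.2.1 j hj)

/-- A product of pseudo-rotations with axes in the span of the first `r` basis vectors fixes the
remaining basis vectors. -/
lemma rotationProduct_row (hn : 1 ≤ n) {r : ℕ} {j : Fin n} (hrj : r ≤ j.val) (hj : 1 ≤ j.val) :
    ∀ {k : ℕ} {p : Fin k → ℝ × EuclideanSpace ℂ (Fin n)} {e : Fin k → ℕ}, (∀ i, e i ≤ r) →
      (∀ i, p i ∈ simpleCell n (e i)) → rotationProduct p j = Pi.single j 1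
  | 0, p, e, _, _ => by
    rw [rotationProduct_zero]
    ext i
    simp [Matrix.one_apply, Pi.single_apply, eq_comm]
  | k + 1, p, e, he, hp => by
    have ih := rotationProduct_row hn hrj hj (p := Fin.init p) (e := Fin.init e)
      (fun i => he _) (fun i => hp _)
    rw [rotationProduct_succ hn, mul_assoc, mul_row_of_row_eq_single
      (pseudoRotation_row_of_eq_zero _ (firstBasisVector_apply_of_pos hj)),
      mul_row_of_row_eq_single ih, pseudoRotation_row_of_mem_simpleCell (hp _) ((he _).trans hrj)]

end RotationProduct

/-! ### Recovering a pseudo-rotation from one of its rows -/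

section Recover

variable {n : ℕ}

/-- The conjugated difference between the `j`-th row of the identity and the row `w`. For the
`j`-th row of a pseudo-rotation it is a multiple of the axis. -/
def rowDefect (j : Fin n) (w : Fin n → ℂ) : EuclideanSpace ℂ (Fin n) :=
  WithLp.toLp 2 (star (Pi.single j 1 - w))

/-- The parameter `(t, x)` of the pseudo-rotation `A_(2πt, x)` with `j`-th row `w`, normalized so
that `x_j > 0`. With `z = 1 - w_j = (1 - e^{2πit}) x_j²` one has `arg z = πt - π/2`, and the vector
`rowDefect j w` is the multiple of `x` by `(1 - e^{-2πit}) x_j`, whose phase is that of `z̄`. -/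
def recoverParam (j : Fin n) (w : Fin n → ℂ) : ℝ × EuclideanSpace ℂ (Fin n) :=
  (1 / 2 + (1 - w j).arg / Real.pi,
    (((‖1 - w j‖⁻¹ : ℝ) : ℂ) * (1 - w j) * ((‖rowDefect j w‖⁻¹ : ℝ) : ℂ)) • rowDefect j w)

lemma rowDefect_apply (j : Fin n) (w : Fin n → ℂ) (i : Fin n) :
    rowDefect j w i = star ((Pi.single j 1 : Fin n → ℂ) i - w i) := rfl

lemma continuous_rowDefect (j : Fin n) : Continuous (rowDefect j) := by
  unfold rowDefect
  fun_prop

lemma rowDefect_ne_zero {j : Fin n} {w : Fin n → ℂ} (h : 0 < (1 - w j).re) :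
    rowDefect j w ≠ 0 := by
  intro h0
  have := congrArg (fun v : EuclideanSpace ℂ (Fin n) => v j) h0
  simp only [rowDefect_apply, Pi.single_eq_same, PiLp.zero_apply, star_eq_zero] at this
  rw [this] at h
  simp at h

lemma continuousAt_recoverParam {j : Fin n} {w : Fin n → ℂ} (h : 0 < (1 - w j).re) :
    ContinuousAt (recoverParam j) w := by
  have hz : ContinuousAt (fun w : Fin n → ℂ => 1 - w j) w :=
    (continuous_const.sub (continuous_apply j)).continuousAt
  have hd := (continuous_rowDefect j).continuousAt (x := w)
  have hz0 : ‖1 - w j‖ ≠ 0 := by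
    rw [norm_ne_zero_iff]
    intro h0
    rw [h0] at h
    simp at h
  have hd0 : ‖rowDefect j w‖ ≠ 0 := norm_ne_zero_iff.2 (rowDefect_ne_zero h)
  refine ContinuousAt.prodMk ?_ ?_
  · exact continuousAt_const.add
      ((ContinuousAt.comp (g := Complex.arg) (f := fun w : Fin n → ℂ => 1 - w j)
        (Complex.continuousAt_arg (Or.inl h)) hz).div_const _)
  · refine ContinuousAt.smul (((?_ : ContinuousAt _ _).mul hz).mul ?_) hd
    · exact Complex.continuous_ofReal.continuousAt.comp (hz.norm.inv₀ hz0)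
    · exact Complex.continuous_ofReal.continuousAt.comp (hd.norm.inv₀ hd0)

lemma one_sub_exp_two_pi_mul (t : ℝ) :
    1 - Complex.exp ((2 * Real.pi * t : ℝ) * Complex.I) =
      ((2 * Real.sin (Real.pi * t) : ℝ) : ℂ) *
        ((Real.sin (Real.pi * t) : ℝ) + ((-Real.cos (Real.pi * t) : ℝ) : ℂ) * Complex.I) := by
  have h : 2 * Real.pi * t = 2 * (Real.pi * t) := by ring
  rw [Complex.exp_mul_I, ← Complex.ofReal_cos, ← Complex.ofReal_sin, h, Real.cos_two_mul,
    Real.sin_two_mul]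
  have := Real.sin_sq_add_cos_sq (Real.pi * t)
  generalize Real.sin (Real.pi * t) = a at *
  generalize Real.cos (Real.pi * t) = b at *
  refine Complex.ext ?_ ?_
  · simp [pow_two]
    nlinarith
  · simp [pow_two]

lemma arg_one_sub_exp_two_pi_mul {t : ℝ} (h0 : 0 < t) (h1 : t < 1) :
    (1 - Complex.exp ((2 * Real.pi * t : ℝ) * Complex.I)).arg = Real.pi * t - Real.pi / 2 := by
  have hpi := Real.pi_pos
  have hs : 0 < Real.sin (Real.pi * t) :=
    Real.sin_pos_of_pos_of_lt_pi (by positivity) (by nlinarith)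
  rw [one_sub_exp_two_pi_mul, ← Real.cos_sub_pi_div_two, ← Real.sin_sub_pi_div_two,
    Complex.ofReal_cos (_ - _), Complex.ofReal_sin (_ - _)]
  rw [Real.cos_sub_pi_div_two]
  refine Complex.arg_mul_cos_add_sin_mul_I (by positivity) ⟨?_, ?_⟩
  · have := mul_pos hpi h0
    linarith
  · have := mul_lt_mul_of_pos_left h1 hpi
    linarith

variable {j : Fin n} {q : ℝ × EuclideanSpace ℂ (Fin n)}

/-- The coordinate `x_j` of the axis of a point of `E_{j+1}` is a positive real number. -/
lemma exists_pos_of_mem_simpleCell (hq : q ∈ simpleCell n (j.val + 1)) :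
    ∃ c : ℝ, 0 < c ∧ q.2 j = c := by
  obtain ⟨-, -, -, i, hi, him, hre⟩ := hq
  obtain rfl : i = j := Fin.ext (by omega)
  exact ⟨(q.2 i).re, hre, Complex.ext rfl him⟩

lemma sin_pi_mul_pos (hq : q ∈ simpleCell n (j.val + 1)) : 0 < Real.sin (Real.pi * q.1) := by
  have hpi := Real.pi_pos
  have h1 := hq.1.1
  have h2 := hq.1.2
  exact Real.sin_pos_of_pos_of_lt_pi (by positivity) (by nlinarith)

lemma one_sub_pseudoRotation_diag_re_pos (hq : q ∈ simpleCell n (j.val + 1)) :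
    0 < (1 - pseudoRotation (2 * Real.pi * q.1) q.2 j j).re := by
  obtain ⟨c, hc, hqc⟩ := exists_pos_of_mem_simpleCell hq
  have hs := sin_pi_mul_pos hq
  rw [pseudoRotation_apply, Matrix.one_apply_eq, hqc, one_sub_exp_two_pi_mul, Complex.star_def,
    Complex.conj_ofReal, sub_sub_cancel, ← Complex.ofReal_mul, mul_comm, Complex.re_ofReal_mul,
    Complex.re_ofReal_mul]
  generalize Real.sin (Real.pi * q.1) = a at *
  simp only [Complex.add_re, Complex.ofReal_re, Complex.re_ofReal_mul, Complex.I_re]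
  nlinarith [mul_pos hc hc, mul_pos hs hs, mul_pos (mul_pos hc hc) (mul_pos hs hs)]

lemma recoverParam_pseudoRotation (hq : q ∈ simpleCell n (j.val + 1)) :
    recoverParam j (pseudoRotation (2 * Real.pi * q.1) q.2 j) = q := by
  obtain ⟨c, hc, hqc⟩ := exists_pos_of_mem_simpleCell hq
  have hs := sin_pi_mul_pos hq
  have hpi := Real.pi_pos
  have hz : 1 - pseudoRotation (2 * Real.pi * q.1) q.2 j j =
      (1 - Complex.exp ((2 * Real.pi * q.1 : ℝ) * Complex.I)) * ((c ^ 2 : ℝ) : ℂ) := by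
    rw [pseudoRotation_apply, Matrix.one_apply_eq, hqc, Complex.star_def, Complex.conj_ofReal,
      sub_sub_cancel]
    push_cast
    ring
  have hv : rowDefect j (pseudoRotation (2 * Real.pi * q.1) q.2 j) =
      (star (1 - Complex.exp ((2 * Real.pi * q.1 : ℝ) * Complex.I)) * (c : ℂ)) • q.2 := by
    ext i
    rw [rowDefect_apply, pseudoRotation_apply, hqc, Matrix.one_apply, Pi.single_apply]
    simp only [eq_comm (a := i), sub_sub_cancel, star_mul', star_star, PiLp.smul_apply,
      smul_eq_mul]
    rw [Complex.star_def, Complex.conj_ofReal]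
    ring
  set a := 1 - Complex.exp ((2 * Real.pi * q.1 : ℝ) * Complex.I) with ha
  have haa := arg_one_sub_exp_two_pi_mul hq.1.1 hq.1.2
  rw [← ha] at haa
  have harg : (a * ((c ^ 2 : ℝ) : ℂ)).arg = Real.pi * q.1 - Real.pi / 2 := by
    rw [mul_comm, Complex.arg_real_mul _ (by positivity), haa]
  have ha0 : a ≠ 0 := by
    intro h0
    have h1 := congrArg Complex.re (one_sub_exp_two_pi_mul q.1)
    rw [← ha, h0, Complex.re_ofReal_mul, Complex.add_re, Complex.ofReal_re,
      Complex.re_ofReal_mul, Complex.I_re, mul_zero, add_zero, Complex.zero_re] at h1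
    nlinarith
  have ha0' : ‖a‖ ≠ 0 := norm_ne_zero_iff.2 ha0
  refine Prod.ext ?_ ?_
  · simp only [recoverParam]
    rw [hz, harg]
    field_simp
    ring
  · simp only [recoverParam]
    rw [hz, hv, norm_smul, norm_mul, norm_mul, norm_star, hq.2.1, smul_smul]
    have hn : (‖a‖ : ℂ) ^ 2 = a * star a := by
      rw [Complex.star_def, Complex.mul_conj, Complex.normSq_eq_norm_sq]
      push_cast
      rfl
    have hc' : (c : ℂ) ≠ 0 := by exact_mod_cast hc.ne'
    have ha0'' : (‖a‖ : ℂ) ≠ 0 := by exact_mod_cast ha0'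
    conv_rhs => rw [← one_smul ℂ q.2]
    congr 1
    simp only [Complex.norm_real, Real.norm_eq_abs, abs_of_pos hc, abs_of_pos (pow_pos hc 2)]
    push_cast
    field_simp
    rw [hn]

/-- Every row of norm one other than that of the identity, with support in the first `j + 1`
coordinates, is the `j`-th row of a pseudo-rotation: the one about the axis `e_j - w̄` that carries
`w̄` to `e_j`. -/
lemma recoverParam_spec {w : Fin n → ℂ} (hw : ∑ i, ‖w i‖ ^ 2 = 1)
    (hne : w ≠ Pi.single j 1) (hsupp : ∀ i, j < i → w i = 0) :
    recoverParam j w ∈ simpleCell n (j.val + 1) ∧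
      pseudoRotation (2 * Real.pi * (recoverParam j w).1) (recoverParam j w).2 j = w := by
  set z := 1 - w j with hz
  set v := rowDefect j w with hv
  have hsplit : ‖w j‖ ^ 2 + ∑ i ∈ Finset.univ.erase j, ‖w i‖ ^ 2 = 1 := by
    rw [Finset.add_sum_erase _ (fun i => ‖w i‖ ^ 2) (Finset.mem_univ j), hw]
  have hvn : ‖v‖ ^ 2 = 2 * z.re := by
    rw [EuclideanSpace.norm_sq_eq, ← Finset.add_sum_erase _ _ (Finset.mem_univ j)]
    have h1 : ∑ i ∈ Finset.univ.erase j, ‖v i‖ ^ 2 = ∑ i ∈ Finset.univ.erase j, ‖w i‖ ^ 2 := by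
      refine Finset.sum_congr rfl fun i hi => ?_
      rw [hv, rowDefect_apply, norm_star, Pi.single_eq_of_ne (Finset.ne_of_mem_erase hi), zero_sub,
        norm_neg]
    rw [h1, eq_sub_of_add_eq' hsplit, hv, rowDefect_apply, norm_star, Pi.single_eq_same,
      ← Complex.normSq_eq_norm_sq, ← Complex.normSq_eq_norm_sq, Complex.normSq_apply,
      Complex.normSq_apply, hz]
    simp
    ring
  have hv0 : v ≠ 0 := by
    intro h0
    refine hne (funext fun i => ?_)
    have h1 := congrArg (fun u : EuclideanSpace ℂ (Fin n) => u i) h0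
    simp only [hv, rowDefect_apply, PiLp.zero_apply, star_eq_zero] at h1
    exact (sub_eq_zero.1 h1).symm
  have hvpos : 0 < ‖v‖ := norm_pos_iff.2 hv0
  have hzre : 0 < z.re := by nlinarith [pow_pos hvpos 2]
  have hz0 : z ≠ 0 := by
    intro h0
    rw [h0] at hzre
    simp at hzre
  have hzpos : 0 < ‖z‖ := norm_pos_iff.2 hz0
  have hpi := Real.pi_pos
  have hzn : (‖z‖ : ℂ) ^ 2 = z * star z := by
    rw [Complex.star_def, Complex.mul_conj, Complex.normSq_eq_norm_sq]
    push_cast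
    rfl
  have hvn' : (‖v‖ : ℂ) ^ 2 = z + star z := by
    rw [Complex.star_def, Complex.add_conj, ← hvn]
    push_cast
    rfl
  have hzC : (‖z‖ : ℂ) ≠ 0 := by exact_mod_cast hzpos.ne'
  have hvC : (‖v‖ : ℂ) ≠ 0 := by exact_mod_cast hvpos.ne'
  have hsz : star z ≠ 0 := star_ne_zero.2 hz0
  have hvj : v j = star z := by rw [hv, rowDefect_apply, Pi.single_eq_same]
  have hxj : (recoverParam j w).2 j = ((‖z‖ * ‖v‖⁻¹ : ℝ) : ℂ) := by
    simp only [recoverParam, PiLp.smul_apply, smul_eq_mul]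
    rw [← hz, ← hv, hvj]
    push_cast
    field_simp
    rw [hzn]
  have hexp : Complex.exp ((2 * Real.pi * (recoverParam j w).1 : ℝ) * Complex.I) * star z = -z := by
    have h1 : ((2 * Real.pi * (recoverParam j w).1 : ℝ) : ℂ) * Complex.I =
        Real.pi * Complex.I + (z.arg * Complex.I + z.arg * Complex.I) := by
      simp only [recoverParam]
      rw [← hz]
      have : 2 * Real.pi * (1 / 2 + z.arg / Real.pi) = Real.pi + (z.arg + z.arg) := by
        field_simp
        ring
      rw [this]
      push_cast
      ring
    have h2 : (‖z‖ : ℂ) * Complex.exp (z.arg * Complex.I) = z := Complex.norm_mul_exp_arg_mul_I z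
    rw [h1, Complex.exp_add, Complex.exp_add, Complex.exp_pi_mul_I]
    set e := Complex.exp (z.arg * Complex.I)
    have h3 : (‖z‖ : ℂ) ^ 2 * (e * e) = z * z := by
      calc (‖z‖ : ℂ) ^ 2 * (e * e) = (‖z‖ * e) * (‖z‖ * e) := by ring
        _ = z * z := by rw [h2]
    refine mul_left_cancel₀ hz0 ?_
    calc z * (-1 * (e * e) * star z) = -(z * star z * (e * e)) := by ring
      _ = z * -z := by rw [← hzn, h3]; ring
  have harg := Complex.abs_arg_lt_pi_div_two_iff.2 (Or.inl hzre)
  rw [abs_lt] at harg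
  refine ⟨⟨⟨?_, ?_⟩, ?_, ?_, j, rfl, ?_, ?_⟩, ?_⟩
  · simp only [recoverParam]
    rw [← hz]
    have : -(1 / 2) < z.arg / Real.pi := by
      rw [lt_div_iff₀ hpi]
      linarith
    linarith
  · simp only [recoverParam]
    rw [← hz]
    have : z.arg / Real.pi < 1 / 2 := by
      rw [div_lt_iff₀ hpi]
      linarith
    linarith
  · simp only [recoverParam]
    rw [← hz, ← hv, norm_smul, norm_mul, norm_mul, Complex.norm_real, Complex.norm_real, norm_inv,
      norm_inv, norm_norm, norm_norm]
    field_simp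
  · intro i hi
    have hij : j < i := Fin.lt_def.2 (by omega)
    simp only [recoverParam, PiLp.smul_apply, smul_eq_mul]
    rw [rowDefect_apply, hsupp i hij, Pi.single_eq_of_ne hij.ne']
    simp
  · rw [hxj, Complex.ofReal_im]
  · rw [hxj, Complex.ofReal_re]
    positivity
  · ext i
    rw [pseudoRotation_apply, hxj]
    have hxi : star ((recoverParam j w).2 i) =
        (‖z‖ : ℂ)⁻¹ * star z * (‖v‖ : ℂ)⁻¹ * ((Pi.single j 1 : Fin n → ℂ) i - w i) := by
      simp only [recoverParam, PiLp.smul_apply, smul_eq_mul]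
      rw [← hz, ← hv, hv, rowDefect_apply, ← hv, star_mul', star_star]
      simp
    rw [hxi]
    set E := Complex.exp ((2 * Real.pi * (recoverParam j w).1 : ℝ) * Complex.I)
    have h1 : (1 : Matrix (Fin n) (Fin n) ℂ) j i = (Pi.single j 1 : Fin n → ℂ) i := by
      simp [Matrix.one_apply, Pi.single_apply, eq_comm]
    rw [h1]
    set d := (Pi.single j 1 : Fin n → ℂ) i
    have h2 : (1 - E) * ((‖z‖ * ‖v‖⁻¹ : ℝ) * ((‖z‖ : ℂ)⁻¹ * star z * (‖v‖ : ℂ)⁻¹ * (d - w i))) =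
        (star z - E * star z) / (‖v‖ : ℂ) ^ 2 * (d - w i) := by
      push_cast
      field_simp
    rw [h2, hexp, hvn', sub_neg_eq_add, add_comm (star z) z, div_self, one_mul, sub_sub_cancel]
    rw [← hvn']
    exact pow_ne_zero 2 hvC

end Recover

/-! ### The parametrization of a Schubert cell is an embedding -/

section Embedding

open Filter Topology

variable {n : ℕ}

/-- The row of `rotationProduct p` just inside the last cell is the row of the last factor, because
the other factors fix the corresponding basis vector. -/
lemma rotationProduct_last_row (hn : 1 ≤ n) {k : ℕ}
    {p : Fin (k + 1) → ℝ × EuclideanSpace ℂ (Fin n)} {e : Fin (k + 1) → ℕ} (he : StrictMono e)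
    (hp : ∀ i, p i ∈ simpleCell n (e i)) {j : Fin n} (hj : j.val + 1 = e (Fin.last k))
    (hj1 : 1 ≤ j.val) :
    rotationProduct p j =
      pseudoRotation (2 * Real.pi * (p (Fin.last k)).1) (p (Fin.last k)).2 j := by
  have h : rotationProduct (Fin.init p) j = Pi.single j 1 := by
    refine rotationProduct_row hn le_rfl hj1 (e := Fin.init e) (fun i => ?_) fun i => hp _
    have := he (Fin.castSucc_lt_last i)
    simp only [Fin.init]
    omega
  rw [rotationProduct_succ hn, mul_assoc, mul_row_of_row_eq_single
    (pseudoRotation_row_of_eq_zero _ (firstBasisVector_apply_of_pos hj1)),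
    mul_row_of_row_eq_single h]

/-- The parameters depend continuously on the product. The factors are recovered one after the
other, starting with the last one, by `recoverParam`. -/
lemma tendsto_of_tendsto_rotationProduct (hn : 1 ≤ n) {ι : Type*} {l : Filter ι} :
    ∀ {k : ℕ} {e : Fin k → ℕ} {p₀ : Fin k → ℝ × EuclideanSpace ℂ (Fin n)}
      {p : ι → Fin k → ℝ × EuclideanSpace ℂ (Fin n)}, StrictMono e → (∀ i, 1 < e i) →
      (∀ i, e i ≤ n) → (∀ i, p₀ i ∈ simpleCell n (e i)) → (∀ a i, p a i ∈ simpleCell n (e i)) →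
      Tendsto (fun a => rotationProduct (p a)) l (𝓝 (rotationProduct p₀)) → Tendsto p l (𝓝 p₀)
  | 0, e, p₀, p, _, _, _, _, _, _ => by
    rw [tendsto_pi_nhds]
    exact fun i => i.elim0
  | k + 1, e, p₀, p, he, he1, hen, hp₀, hp, h => by
    have hlast1 := he1 (Fin.last k)
    have hlastn := hen (Fin.last k)
    let j : Fin n := ⟨e (Fin.last k) - 1, by omega⟩
    have hj : j.val + 1 = e (Fin.last k) := by simp only [j]; omega
    have hj1 : 1 ≤ j.val := by simp only [j]; omega
    have hcell {q} (hq : q ∈ simpleCell n (e (Fin.last k))) : q ∈ simpleCell n (j.val + 1) :=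
      hj.symm ▸ hq
    have hlast : Tendsto (fun a => p a (Fin.last k)) l (𝓝 (p₀ (Fin.last k))) := by
      have h1 := (tendsto_pi_nhds.1 h) j
      simp only [rotationProduct_last_row hn he hp₀ hj hj1,
        fun a => rotationProduct_last_row hn he (hp a) hj hj1] at h1
      have h2 := (continuousAt_recoverParam
        (one_sub_pseudoRotation_diag_re_pos (hcell (hp₀ (Fin.last k))))).tendsto.comp h1
      simpa only [Function.comp_def, recoverParam_pseudoRotation (hcell (hp₀ (Fin.last k))),
        fun a => recoverParam_pseudoRotation (hcell (hp a (Fin.last k)))] using h2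
    have key {q : Fin (k + 1) → ℝ × EuclideanSpace ℂ (Fin n)}
        (hq : ∀ i, q i ∈ simpleCell n (e i)) : rotationProduct (Fin.init q) =
          pseudoRotation (2 * Real.pi * (q (Fin.last k)).1) (firstBasisVector n) *
            rotationProduct q *
            pseudoRotation (-(2 * Real.pi * (q (Fin.last k)).1)) (q (Fin.last k)).2 := by
      rw [rotationProduct_succ hn q, mul_assoc, mul_assoc _ (pseudoRotation _ (q (Fin.last k)).2),
        pseudoRotation_mul_neg (norm_of_mem_simpleCell (hq _)), mul_one, ← mul_assoc,
        pseudoRotation_mul_neg (norm_firstBasisVector hn), one_mul]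
    have hinit : Tendsto (fun a => Fin.init (p a)) l (𝓝 (Fin.init p₀)) := by
      refine tendsto_of_tendsto_rotationProduct hn (e := Fin.init e)
        (he.comp (Fin.strictMono_castSucc)) (fun i => he1 _) (fun i => hen _) (fun i => hp₀ _)
        (fun a i => hp a _) ?_
      rw [key hp₀]
      simp only [fun a => key (hp a)]
      refine ((((continuous_pseudoRotation.comp (f := fun q : ℝ × EuclideanSpace ℂ (Fin n) =>
        (2 * Real.pi * q.1, firstBasisVector n)) (by fun_prop)).tendsto _).comp hlast).mul h).mul
        (((continuous_pseudoRotation.comp (f := fun q : ℝ × EuclideanSpace ℂ (Fin n) =>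
        (-(2 * Real.pi * q.1), q.2)) (by fun_prop)).tendsto _).comp hlast)
    rw [tendsto_pi_nhds]
    exact fun i => Fin.lastCases hlast (fun i => (tendsto_pi_nhds.1 hinit) i) i

lemma SchubertSymbol.isEmbedding_psi (hn : 1 ≤ n) (s : SchubertSymbol n) :
    IsEmbedding fun p : s.paramCell => s.psi p.1 := by
  have hmem (p : s.paramCell) (i) : p.1 i ∈ simpleCell n (s.entry i) := p.2 i trivial
  refine ⟨isInducing_iff_nhds.2 fun p => le_antisymm ?_ ?_, fun p q hpq => ?_⟩
  · rw [← tendsto_iff_comap]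
    exact (continuous_rotationProduct.comp continuous_subtype_val).tendsto p
  · have := tendsto_of_tendsto_rotationProduct hn s.strictMono s.one_lt s.le (hmem p) hmem
      (l := comap (fun p : s.paramCell => s.psi p.1) (𝓝 (s.psi p.1))) tendsto_comap
    exact tendsto_id'.1 (tendsto_subtype_rng.2 this)
  · -- a constant family converging to `q` is equal to `q`
    have := tendsto_of_tendsto_rotationProduct hn s.strictMono s.one_lt s.le (hmem q)
      (fun _ : Unit => hmem p) (l := pure ()) (by
        have h : rotationProduct p.1 = rotationProduct q.1 := hpq
        rw [h]
        exact tendsto_const_nhds)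
    exact Subtype.ext (tendsto_nhds_unique tendsto_const_nhds this)

end Embedding

/-! ### Every special unitary matrix lies in a Schubert cell -/

section Existence

variable {n : ℕ}

lemma row_norm_of_mem_unitaryGroup {U : Matrix (Fin n) (Fin n) ℂ}
    (hU : U ∈ Matrix.unitaryGroup (Fin n) ℂ) (j : Fin n) : ∑ i, ‖U j i‖ ^ 2 = 1 := by
  have h := congrFun (congrFun (Matrix.mem_unitaryGroup_iff.1 hU) j) j
  rw [Matrix.mul_apply, Matrix.one_apply_eq] at h
  have h1 : ∑ i, ((‖U j i‖ ^ 2 : ℝ) : ℂ) = 1 := by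
    rw [← h]
    refine Finset.sum_congr rfl fun i _ => ?_
    rw [Matrix.star_apply, Complex.star_def, Complex.mul_conj, Complex.normSq_eq_norm_sq]
  exact_mod_cast h1

/-- If a unitary matrix has the `i`-th row of the identity, then it also has its `i`-th column. -/
lemma apply_eq_zero_of_row_eq_single {U : Matrix (Fin n) (Fin n) ℂ}
    (hU : U ∈ Matrix.unitaryGroup (Fin n) ℂ) {i j : Fin n} (hi : U i = Pi.single i 1)
    (hij : j ≠ i) : U j i = 0 := by
  have h := congrFun (congrFun (Matrix.mem_unitaryGroup_iff.1 hU) j) i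
  rw [Matrix.mul_apply, Matrix.one_apply_ne hij, Finset.sum_eq_single i] at h
  · simpa [Matrix.star_apply, hi] using h
  · intro l _ hl
    simp [Matrix.star_apply, hi, Pi.single_eq_of_ne hl]
  · simp

/-- Induction on `r` over the subgroups `SU_r`: a pseudo-rotation in `U_{r+1}` moves the last row
of the given matrix back to that of the identity. -/
lemma exists_rotationProduct_eq (hn : 1 ≤ n) {r : ℕ} (hr : 1 ≤ r) : r ≤ n →
    ∀ U ∈ Matrix.specialUnitaryGroup (Fin n) ℂ, (∀ j : Fin n, r ≤ j.val → U j = Pi.single j 1) →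
      ∃ (k : ℕ) (e : Fin k → ℕ) (p : Fin k → ℝ × EuclideanSpace ℂ (Fin n)), StrictMono e ∧
        (∀ i, 1 < e i) ∧ (∀ i, e i ≤ r) ∧ (∀ i, p i ∈ simpleCell n (e i)) ∧
        rotationProduct p = U := by
  induction r, hr using Nat.le_induction with
  | base =>
    intro _ U hU hrow
    rw [Matrix.mem_specialUnitaryGroup_iff] at hU
    refine ⟨0, Fin.elim0, Fin.elim0, fun i => i.elim0, fun i => i.elim0, fun i => i.elim0,
      fun i => i.elim0, ?_⟩
    rw [rotationProduct_zero]
    let z : Fin n := ⟨0, hn⟩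
    have hz (j : Fin n) (hj : j ≠ z) : 1 ≤ j.val := by
      have : j.val ≠ 0 := fun h => hj (Fin.ext h)
      omega
    have hdiag : U = Matrix.diagonal fun j => U j j := by
      ext i j
      by_cases hij : i = j
      · rw [hij, Matrix.diagonal_apply_eq]
      · rw [Matrix.diagonal_apply_ne _ hij]
        by_cases hi : i = z
        · exact apply_eq_zero_of_row_eq_single hU.1 (hrow j (hz j fun h => hij (hi.trans h.symm))) hij
        · rw [hrow i (hz i hi), Pi.single_eq_of_ne (Ne.symm hij)]
    have hdet := hU.2
    rw [hdiag, Matrix.det_diagonal, Finset.prod_eq_single z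
      (fun j _ hj => by rw [hrow j (hz j hj), Pi.single_eq_same]) (by simp)] at hdet
    rw [hdiag, ← Matrix.diagonal_one]
    congr 1
    ext j
    by_cases hj : j = z
    · rw [hj, hdet]
    · rw [hrow j (hz j hj), Pi.single_eq_same]
  | succ r hr ih =>
    intro hrn U hU hrow
    let j : Fin n := ⟨r, hrn⟩
    by_cases hUj : U j = Pi.single j 1
    · obtain ⟨k, e, p, he, he1, her, hp, h⟩ := ih (Nat.le_of_succ_le hrn) U hU fun i hi => by
        by_cases hij : i = j
        · rw [hij, hUj]
        · exact hrow i (by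
            have : i.val ≠ r := fun h => hij (Fin.ext h)
            omega)
      exact ⟨k, e, p, he, he1, fun i => (her i).trans r.le_succ, hp, h⟩
    · have hU' := Matrix.mem_specialUnitaryGroup_iff.1 hU
      obtain ⟨hq, hqrow⟩ := recoverParam_spec (row_norm_of_mem_unitaryGroup hU'.1 j) hUj
        fun i hi => apply_eq_zero_of_row_eq_single hU'.1 (hrow i (Fin.lt_def.1 hi)) hi.ne
      set q := recoverParam j (U j)
      set θ := 2 * Real.pi * q.1
      have hx := norm_of_mem_simpleCell hq
      have he := norm_firstBasisVector hn
      let V := pseudoRotation θ (firstBasisVector n) * U * pseudoRotation (-θ) q.2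
      have hUV : pseudoRotation (-θ) (firstBasisVector n) * V * pseudoRotation θ q.2 = U := by
        simp only [V]
        rw [mul_assoc, mul_assoc _ _ (pseudoRotation θ q.2), pseudoRotation_neg_mul hx, mul_one,
          ← mul_assoc, pseudoRotation_neg_mul he, one_mul]
      have hVrow (i : Fin n) (hi : r ≤ i.val) : V i = Pi.single i 1 := by
        simp only [V]
        rw [mul_assoc, mul_row_of_row_eq_single (pseudoRotation_row_of_eq_zero _
          (firstBasisVector_apply_of_pos (hr.trans hi)))]
        by_cases hij : i = j
        · rw [hij, Matrix.mul_apply_eq_vecMul, ← hqrow, ← Matrix.mul_apply_eq_vecMul,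
            pseudoRotation_mul_neg hx]
          ext l
          simp [Matrix.one_apply, Pi.single_apply, eq_comm]
        · have hi' : r + 1 ≤ i.val := by
            have : i.val ≠ r := fun h => hij (Fin.ext h)
            omega
          rw [mul_row_of_row_eq_single (hrow i hi'), pseudoRotation_row_of_mem_simpleCell hq hi']
      have hV : V ∈ Matrix.specialUnitaryGroup (Fin n) ℂ := by
        rw [Matrix.mem_specialUnitaryGroup_iff]
        refine ⟨mul_mem (mul_mem (pseudoRotation_mem_unitaryGroup _ he) hU'.1)
          (pseudoRotation_mem_unitaryGroup _ hx), ?_⟩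
        rw [Matrix.det_mul, Matrix.det_mul, hU'.2, det_pseudoRotation _ hx,
          det_pseudoRotation _ he, mul_one, ← Complex.exp_add]
        simp
      obtain ⟨k, e, p, he, he1, her, hp, h⟩ := ih (Nat.le_of_succ_le hrn) V hV hVrow
      refine ⟨k + 1, Fin.snoc e (r + 1), Fin.snoc p q, ?_, ?_, ?_, ?_, ?_⟩
      · intro a b hab
        induction b using Fin.lastCases with
        | last =>
          induction a using Fin.lastCases with
          | last => exact absurd hab (lt_irrefl _)
          | cast a => simpa using Nat.lt_succ_of_le (her a)
        | cast b =>
          induction a using Fin.lastCases with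
          | last => exact absurd hab (Fin.castSucc_lt_last b).not_gt
          | cast a => simpa using he (Fin.castSucc_lt_castSucc_iff.1 hab)
      · intro i
        induction i using Fin.lastCases with
        | last => simpa using Nat.lt_succ_of_le hr
        | cast i => simpa using he1 i
      · intro i
        induction i using Fin.lastCases with
        | last => simp
        | cast i => simpa using (her i).trans r.le_succ
      · intro i
        induction i using Fin.lastCases with
        | last => simpa using hq
        | cast i => simpa using hp i
      · rw [rotationProduct_succ hn, Fin.init_snoc, Fin.snoc_last, h, hUV]

lemma exists_mem_schubertCell (hn : 1 ≤ n) {U : Matrix (Fin n) (Fin n) ℂ}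
    (hU : U ∈ Matrix.specialUnitaryGroup (Fin n) ℂ) : ∃ s : SchubertSymbol n, U ∈ s.schubertCell := by
  obtain ⟨k, e, p, he, he1, hen, hp, h⟩ := exists_rotationProduct_eq hn hn le_rfl U hU
    fun j hj => absurd j.2 hj.not_gt
  exact ⟨⟨k, e, he, he1, hen⟩, p, fun i _ => hp i, h⟩

lemma SchubertSymbol.schubertCell_subset (hn : 1 ≤ n) (s : SchubertSymbol n) :
    s.schubertCell ⊆ (Matrix.specialUnitaryGroup (Fin n) ℂ : Set (Matrix (Fin n) (Fin n) ℂ)) := by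
  rintro _ ⟨p, hp, rfl⟩
  exact rotationProduct_mem_specialUnitaryGroup hn fun i => norm_of_mem_simpleCell (hp i trivial)

end Existence

/-! ### The rank invariants of a Schubert cell -/

section Rank

variable {n : ℕ}

/-- The matrix `M - 1` with its first `r` rows replaced by zero. -/
def lowerDefect (r : ℕ) (M : Matrix (Fin n) (Fin n) ℂ) : Matrix (Fin n) (Fin n) ℂ :=
  Matrix.of fun i j => if r ≤ i.val then M i j - (1 : Matrix (Fin n) (Fin n) ℂ) i j else 0

/-- The vector `v` with its first `r` coordinates replaced by zero. -/
def lowerPart (r : ℕ) : (Fin n → ℂ) →ₗ[ℂ] Fin n → ℂ where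
  toFun v i := if r ≤ i.val then v i else 0
  map_add' v w := by
    ext i
    simp only [Pi.add_apply]
    split_ifs <;> simp
  map_smul' c v := by
    ext i
    simp

lemma lowerPart_apply (r : ℕ) (v : Fin n → ℂ) (i : Fin n) :
    lowerPart r v i = if r ≤ i.val then v i else 0 := rfl

lemma lowerDefect_mulVec (r : ℕ) (M : Matrix (Fin n) (Fin n) ℂ) (v : Fin n → ℂ) :
    lowerDefect r M *ᵥ v = lowerPart r (M *ᵥ v - v) := by
  ext i
  rw [lowerPart_apply]
  split_ifs with h
  · have : lowerDefect r M i = (M - 1) i := by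
      ext j
      simp [lowerDefect, h]
    have h2 : (M *ᵥ v - v) i = ((M - 1) *ᵥ v) i := by rw [Matrix.sub_mulVec, Matrix.one_mulVec]
    rw [h2, Matrix.mulVec, this]
    rfl
  · have : lowerDefect r M i = 0 := by
      ext j
      simp [lowerDefect, h]
    rw [Matrix.mulVec, this, zero_dotProduct]

lemma lowerDefect_mul_of_row_eq_single {r : ℕ} {E : Matrix (Fin n) (Fin n) ℂ}
    (hE : ∀ i : Fin n, r ≤ i.val → E i = Pi.single i 1) (M : Matrix (Fin n) (Fin n) ℂ) :
    lowerDefect r (E * M) = lowerDefect r M := by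
  ext i j
  simp only [lowerDefect, Matrix.of_apply]
  split_ifs with h
  · rw [mul_row_of_row_eq_single (hE i h)]
  · rfl

lemma lowerDefect_one (r : ℕ) : lowerDefect r (1 : Matrix (Fin n) (Fin n) ℂ) = 0 := by
  ext i j
  simp [lowerDefect]

lemma pseudoRotation_mulVec (θ : ℝ) (x : EuclideanSpace ℂ (Fin n)) (v : Fin n → ℂ) :
    pseudoRotation θ x *ᵥ v =
      v - ((1 - Complex.exp (θ * Complex.I)) * (star x.ofLp ⬝ᵥ v)) • x.ofLp := by
  rw [pseudoRotation, Matrix.sub_mulVec, Matrix.one_mulVec, Matrix.smul_mulVec,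
    Matrix.vecMulVec_mulVec]
  simp [smul_smul]

/-- Multiplying by a pseudo-rotation whose axis leaves the span of the first `j` basis vectors,
while `P` fixes `e_j`, adds the axis to the range of the defect. -/
lemma range_lowerDefect_mul_pseudoRotation (r : ℕ) {P : Matrix (Fin n) (Fin n) ℂ} {θ : ℝ}
    {x : EuclideanSpace ℂ (Fin n)} {j : Fin n} (hP : P *ᵥ Pi.single j 1 = Pi.single j 1)
    (hx : x j ≠ 0) (hθ : 1 - Complex.exp (θ * Complex.I) ≠ 0) :
    LinearMap.range (lowerDefect r (P * pseudoRotation θ x)).mulVecLin =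
      LinearMap.range (lowerDefect r P).mulVecLin ⊔ Submodule.span ℂ {lowerPart r x.ofLp} := by
  set c := 1 - Complex.exp (θ * Complex.I)
  have key (v : Fin n → ℂ) : lowerDefect r (P * pseudoRotation θ x) *ᵥ v =
      lowerDefect r P *ᵥ (pseudoRotation θ x *ᵥ v) -
        (c * (star x.ofLp ⬝ᵥ v)) • lowerPart r x.ofLp := by
    rw [lowerDefect_mulVec, lowerDefect_mulVec, ← map_smul, ← map_sub, ← Matrix.mulVec_mulVec,
      pseudoRotation_mulVec]
    congr 1
    abel
  have hxj : star x.ofLp ⬝ᵥ Pi.single j 1 = star (x j) := by simp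
  have hle : LinearMap.range (lowerDefect r P).mulVecLin ≤
      LinearMap.range (lowerDefect r (P * pseudoRotation θ x)).mulVecLin := by
    rintro _ ⟨v, rfl⟩
    -- `v` is changed by a multiple of `e_j`, invisible to `P - 1`, to become orthogonal to `x`
    refine ⟨v - ((star x.ofLp ⬝ᵥ v) / star (x j)) • Pi.single j 1, ?_⟩
    have h0 : star x.ofLp ⬝ᵥ (v - ((star x.ofLp ⬝ᵥ v) / star (x j)) • Pi.single j 1) = 0 := by
      rw [dotProduct_sub, dotProduct_smul, hxj, smul_eq_mul, div_mul_cancel₀ _ (star_ne_zero.2 hx),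
        sub_self]
    simp only [Matrix.mulVecLin_apply]
    rw [key, pseudoRotation_mulVec, h0, mul_zero, zero_smul, zero_smul, sub_zero, sub_zero,
      Matrix.mulVec_sub, Matrix.mulVec_smul, lowerDefect_mulVec r P (Pi.single j 1), hP, sub_self,
      map_zero, smul_zero, sub_zero]
  refine le_antisymm ?_ (sup_le hle ?_)
  · rintro _ ⟨v, rfl⟩
    rw [Matrix.mulVecLin_apply, key]
    exact sub_mem (Submodule.mem_sup_left ⟨_, rfl⟩)
      (Submodule.mem_sup_right (Submodule.smul_mem _ _ (Submodule.mem_span_singleton_self _)))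
  · rw [Submodule.span_singleton_le_iff_mem]
    have h1 := key (Pi.single j 1)
    rw [hxj, eq_sub_iff_add_eq', ← eq_sub_iff_add_eq] at h1
    have h2 : (c * star (x j)) • lowerPart r x.ofLp ∈
        LinearMap.range (lowerDefect r (P * pseudoRotation θ x)).mulVecLin := by
      rw [h1]
      exact sub_mem (hle ⟨_, rfl⟩) ⟨_, rfl⟩
    exact (Submodule.smul_mem_iff _ (mul_ne_zero hθ (star_ne_zero.2 hx))).1 h2

/-- The number of entries of a symbol exceeding `r`. -/
def tailCount {k : ℕ} (e : Fin k → ℕ) (r : ℕ) : ℕ := ∑ i, if r < e i then 1 else 0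

/-- The symbol of a Schubert cell is encoded in ranks: for a product of pseudo-rotations with
symbol `e`, the rows of `U - 1` beyond the `r`-th one have rank `#{i | r < e i}`. -/
lemma rank_lowerDefect_rotationProduct (hn : 1 ≤ n) {r : ℕ} (hr : 1 ≤ r) :
    ∀ {k : ℕ} {e : Fin k → ℕ} {p : Fin k → ℝ × EuclideanSpace ℂ (Fin n)}, StrictMono e →
      (∀ i, 1 < e i) → (∀ i, e i ≤ n) → (∀ i, p i ∈ simpleCell n (e i)) →
      (lowerDefect r (rotationProduct p)).rank = tailCount e r
  | 0, e, p, _, _, _, _ => by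
    rw [rotationProduct_zero, lowerDefect_one, Matrix.rank_zero, tailCount]
    simp
  | k + 1, e, p, he, he1, hen, hp => by
    have ih := rank_lowerDefect_rotationProduct hn hr (e := Fin.init e) (p := Fin.init p)
      (he.comp Fin.strictMono_castSucc) (fun i => he1 _) (fun i => hen _) (fun i => hp _)
    have hlast1 := he1 (Fin.last k)
    have hlastn := hen (Fin.last k)
    let j : Fin n := ⟨e (Fin.last k) - 1, by omega⟩
    have hj : j.val + 1 = e (Fin.last k) := by simp only [j]; omega
    have hj1 : 1 ≤ j.val := by simp only [j]; omega
    have hq : p (Fin.last k) ∈ simpleCell n (j.val + 1) := hj.symm ▸ hp _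
    set P := rotationProduct (Fin.init p) with hPdef
    set q := p (Fin.last k)
    have hProw : P j = Pi.single j 1 := by
      refine rotationProduct_row hn le_rfl hj1 (e := Fin.init e) (fun i => ?_) fun i => hp _
      have := he (Fin.castSucc_lt_last i)
      simp only [Fin.init]
      omega
    have hPU : P ∈ Matrix.unitaryGroup (Fin n) ℂ :=
      (Matrix.mem_specialUnitaryGroup_iff.1 (rotationProduct_mem_specialUnitaryGroup hn
        fun i => norm_of_mem_simpleCell (hp _))).1
    have hPcol : P *ᵥ Pi.single j 1 = Pi.single j 1 := by
      ext i
      rw [Matrix.mulVec_single_one, Matrix.col_apply]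
      by_cases hij : i = j
      · rw [hij, hProw]
      · rw [apply_eq_zero_of_row_eq_single hPU hProw hij, Pi.single_eq_of_ne hij]
    obtain ⟨c, hc, hqc⟩ := exists_pos_of_mem_simpleCell hq
    have hqj : q.2 j ≠ 0 := by
      rw [hqc]
      exact Complex.ofReal_ne_zero.2 hc.ne'
    have hθ : 1 - Complex.exp ((2 * Real.pi * q.1 : ℝ) * Complex.I) ≠ 0 := by
      intro h0
      have h1 := one_sub_pseudoRotation_diag_re_pos hq
      rw [pseudoRotation_apply, h0] at h1
      simp at h1
    have hrange := range_lowerDefect_mul_pseudoRotation r hPcol hqj hθ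
    have hcount : tailCount e r = tailCount (Fin.init e) r + if r < j.val + 1 then 1 else 0 := by
      rw [tailCount, Fin.sum_univ_castSucc, hj]
      rfl
    rw [rotationProduct_succ hn, mul_assoc, lowerDefect_mul_of_row_eq_single
      (fun i hi => pseudoRotation_row_of_eq_zero _ (firstBasisVector_apply_of_pos (hr.trans hi))),
      Matrix.rank, hrange, hcount, ← ih, Matrix.rank]
    split_ifs with hrj
    · have hne : lowerPart r q.2.ofLp ≠ 0 := by
        intro h0
        have h1 := congrFun h0 j
        rw [lowerPart_apply, if_pos (Nat.lt_succ_iff.1 hrj)] at h1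
        exact hqj h1
      have hdisj : LinearMap.range (lowerDefect r P).mulVecLin ⊓
          Submodule.span ℂ {lowerPart r q.2.ofLp} = ⊥ := by
        rw [← disjoint_iff, Submodule.disjoint_span_singleton' hne]
        rintro ⟨v, hv⟩
        have h1 := congrFun hv j
        rw [Matrix.mulVecLin_apply, lowerDefect_mulVec, lowerPart_apply, lowerPart_apply,
          if_pos (Nat.lt_succ_iff.1 hrj), if_pos (Nat.lt_succ_iff.1 hrj), Pi.sub_apply,
          Matrix.mulVec, hProw, single_one_dotProduct, sub_self] at h1
        exact hqj h1.symm
      have := Submodule.finrank_sup_add_finrank_inf_eq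
        (LinearMap.range (lowerDefect r P).mulVecLin) (Submodule.span ℂ {lowerPart r q.2.ofLp})
      rwa [hdisj, finrank_bot, finrank_span_singleton hne, add_zero] at this
    · have h0 : lowerPart r q.2.ofLp = 0 := by
        ext i
        rw [lowerPart_apply]
        split_ifs with hi
        · exact hq.2.2.1 i (by omega)
        · rfl
      rw [h0, Submodule.span_zero_singleton, sup_bot_eq, add_zero]

lemma SchubertSymbol.rank_lowerDefect (hn : 1 ≤ n) (s : SchubertSymbol n)
    {U : Matrix (Fin n) (Fin n) ℂ} (hU : U ∈ s.schubertCell) {r : ℕ} (hr : 1 ≤ r) :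
    (lowerDefect r U).rank = tailCount s.entry r := by
  obtain ⟨p, hp, rfl⟩ := hU
  exact rank_lowerDefect_rotationProduct hn hr s.strictMono s.one_lt s.le fun i => hp i trivial

lemma continuous_lowerDefect (r : ℕ) :
    Continuous (lowerDefect r : Matrix (Fin n) (Fin n) ℂ → Matrix (Fin n) (Fin n) ℂ) := by
  refine continuous_matrix fun i j => ?_
  simp only [lowerDefect, Matrix.of_apply]
  split_ifs
  · exact (continuous_id.matrix_elem i j).sub continuous_const
  · exact continuous_const

lemma isClosed_setOf_rank_le (c : ℕ) :
    IsClosed {M : Matrix (Fin n) (Fin n) ℂ | M.rank ≤ c} := by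
  let Φ : Matrix (Fin n) (Fin n) ℂ →ₗ[ℂ] (Fin n → ℂ) →L[ℂ] (Fin n → ℂ) :=
    (LinearMap.toContinuousLinearMap (𝕜 := ℂ)).toLinearMap ∘ₗ Matrix.toLin'.toLinearMap
  have hΦ : Continuous Φ := LinearMap.continuous_of_finiteDimensional _
  have h := (isOpen_setOfPred_nat_le_rank (𝕜 := ℂ) (E := Fin n → ℂ) (F := Fin n → ℂ)
    (c + 1)).preimage hΦ
  rw [← isOpen_compl_iff]
  convert h using 1
  ext M
  have h1 : ((Φ M : (Fin n → ℂ) →L[ℂ] (Fin n → ℂ)) : (Fin n → ℂ) →ₗ[ℂ] Fin n → ℂ) =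
      M.mulVecLin := rfl
  simp only [Set.mem_compl_iff, Set.mem_ofPred_eq, not_le, Set.mem_preimage]
  rw [h1, LinearMap.rank, ← Module.finrank_eq_rank, Nat.cast_le, Matrix.rank, Nat.succ_le_iff]

/-- Ranks do not increase under passage to the closure. -/
lemma SchubertSymbol.tailCount_le_of_mem_closure (hn : 1 ≤ n) {s s' : SchubertSymbol n}
    {U : Matrix (Fin n) (Fin n) ℂ} (hU : U ∈ closure s.schubertCell) (hU' : U ∈ s'.schubertCell)
    {r : ℕ} (hr : 1 ≤ r) : tailCount s'.entry r ≤ tailCount s.entry r := by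
  have hcl := (isClosed_setOf_rank_le (n := n) (tailCount s.entry r)).preimage
    (continuous_lowerDefect r)
  have h : (lowerDefect r U).rank ≤ tailCount s.entry r :=
    closure_minimal (t := lowerDefect r ⁻¹' {M | M.rank ≤ tailCount s.entry r})
      (fun V hV => (s.rank_lowerDefect hn hV hr).le) hcl hU
  rwa [s'.rank_lowerDefect hn hU' hr] at h

/-- A symbol is determined by the numbers of its entries beyond each `r`. -/
lemma SchubertSymbol.eq_of_tailCount_eq {s s' : SchubertSymbol n}
    (h : ∀ r, 1 ≤ r → r < n → tailCount s.entry r = tailCount s'.entry r) : s = s' := by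
  have hall (r : ℕ) (hr : 1 ≤ r) : tailCount s.entry r = tailCount s'.entry r := by
    by_cases hrn : r < n
    · exact h r hr hrn
    · simp only [tailCount]
      rw [Finset.sum_eq_zero fun i _ => if_neg (by have := s.le i; omega),
        Finset.sum_eq_zero fun i _ => if_neg (by have := s'.le i; omega)]
  have hrange : Set.range s.entry = Set.range s'.entry := by
    -- `a` is an entry exactly if the count drops between `a - 1` and `a`
    have hmem (t : SchubertSymbol n) (a : ℕ) (ha : 1 < a) :
        a ∈ Set.range t.entry ↔ tailCount t.entry a < tailCount t.entry (a - 1) := by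
      constructor
      · rintro ⟨i, rfl⟩
        refine Finset.sum_lt_sum (fun l _ => ?_) ⟨i, Finset.mem_univ i, ?_⟩
        · split_ifs <;> omega
        · rw [if_neg (lt_irrefl _), if_pos (by omega)]
          exact one_pos
      · intro hlt
        obtain ⟨i, -, hi⟩ := Finset.exists_lt_of_sum_lt hlt
        refine ⟨i, ?_⟩
        split_ifs at hi <;> omega
    ext a
    by_cases ha : 1 < a
    · rw [hmem s a ha, hmem s' a ha, hall a ha.le, hall (a - 1) (by omega)]
    · constructor
      · rintro ⟨i, rfl⟩
        exact absurd (s.one_lt i) ha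
      · rintro ⟨i, rfl⟩
        exact absurd (s'.one_lt i) ha
  obtain ⟨k, e, he, he1, hen⟩ := s
  obtain ⟨k', e', he', he1', hen'⟩ := s'
  obtain rfl : k = k' := by
    have h1 := Set.ncard_range_of_injective he.injective
    have h2 := Set.ncard_range_of_injective he'.injective
    simp only [Nat.card_eq_fintype_card, Fintype.card_fin] at h1 h2
    rw [← h1, ← h2]
    exact congrArg Set.ncard hrange
  obtain rfl : e = e' := (StrictMono.range_inj he he').1 hrange
  rfl

/-- The dimension of a Schubert cell in terms of its rank invariants. -/
lemma SchubertSymbol.dim_eq (s : SchubertSymbol n) :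
    s.dim = tailCount s.entry 1 + 2 * ∑ r ∈ Finset.Ico 1 n, tailCount s.entry r := by
  simp only [SchubertSymbol.dim, tailCount]
  rw [Finset.sum_comm, Finset.mul_sum, ← Finset.sum_add_distrib]
  refine Finset.sum_congr rfl fun i _ => ?_
  have h1 := s.one_lt i
  have h2 := s.le i
  have : (Finset.Ico 1 n).filter (· < s.entry i) = Finset.Ico 1 (s.entry i) := by
    ext r
    simp only [Finset.mem_filter, Finset.mem_Ico]
    omega
  rw [← Finset.card_filter, this, Nat.card_Ico, if_pos h1]
  omega

lemma SchubertSymbol.dim_lt_of_tailCount_le {s s' : SchubertSymbol n}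
    (h : ∀ r, 1 ≤ r → tailCount s'.entry r ≤ tailCount s.entry r) (hne : s' ≠ s) :
    s'.dim < s.dim := by
  rw [s.dim_eq, s'.dim_eq]
  refine add_lt_add_of_le_of_lt (h 1 le_rfl) (Nat.mul_lt_mul_of_pos_left ?_ two_pos)
  refine Finset.sum_lt_sum (fun r hr => h r (Finset.mem_Ico.1 hr).1) ?_
  by_contra! hcon
  exact hne (SchubertSymbol.eq_of_tailCount_eq fun r h1 h2 =>
    le_antisymm (h r h1) (hcon r (Finset.mem_Ico.2 ⟨h1, h2⟩)))

end Rank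

/-! ### The Iwasawa decomposition -/

section Iwasawa

open Topology

variable {m : ℕ}

lemma det_of_forall_lt_eq_zero {B : Matrix (Fin m) (Fin m) ℂ} (h : ∀ i j, j < i → B i j = 0) :
    B.det = ∏ i, B i i :=
  Matrix.det_of_isUpperTriangular fun i j hij => h i j hij

/-- `Sol_m` consists of the upper triangular matrices of determinant one with positive diagonal. -/
lemma mem_iwasawaSol_iff {B : Matrix (Fin m) (Fin m) ℂ} :
    B ∈ iwasawaSol m ↔ (∀ i j, j < i → B i j = 0) ∧ (∀ i, (B i i).im = 0 ∧ 0 < (B i i).re) ∧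
      B.det = 1 := by
  constructor
  · rintro ⟨D, ⟨⟨d, hd, rfl⟩, hdet⟩, N, ⟨hN, hN1⟩, rfl⟩
    refine ⟨fun i j hij => ?_, fun i => ?_, ?_⟩
    · simp [Matrix.diagonal_mul, hN i j hij]
    · simp [Matrix.diagonal_mul, hN1, hd]
    · simp only [Matrix.det_mul, hdet, det_of_forall_lt_eq_zero hN, hN1]
      simp
  · rintro ⟨hB, hd, hdet⟩
    have hre (i) : B i i = ((B i i).re : ℂ) := Complex.ext rfl (hd i).1
    have hne (i) : B i i ≠ 0 := by
      intro h0
      have := (hd i).2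
      rw [h0] at this
      simp at this
    refine ⟨Matrix.diagonal fun i => ((B i i).re : ℂ), ⟨⟨_, fun i => (hd i).2, rfl⟩, ?_⟩,
      (Matrix.diagonal fun i => (B i i)⁻¹) * B, ⟨fun i j hij => ?_, fun i => ?_⟩, ?_⟩
    · rw [Matrix.det_diagonal, ← hdet, det_of_forall_lt_eq_zero hB]
      exact Finset.prod_congr rfl fun i _ => (hre i).symm
    · rw [Matrix.diagonal_mul, hB i j hij, mul_zero]
    · rw [Matrix.diagonal_mul, inv_mul_cancel₀ (hne i)]
    · ext i j
      simp only [← hre]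
      rw [Matrix.diagonal_mul, Matrix.diagonal_mul, mul_inv_cancel_left₀ (hne i)]

lemma isClosed_iwasawaSol : IsClosed (iwasawaSol m) := by
  -- a zero diagonal entry is excluded by the determinant, so positivity may be relaxed
  have : iwasawaSol m = {B | (∀ i j, j < i → B i j = 0) ∧
      (∀ i, (B i i).im = 0 ∧ 0 ≤ (B i i).re) ∧ B.det = 1} := by
    ext B
    rw [mem_iwasawaSol_iff]
    refine and_congr_right fun hB => ⟨fun h => ⟨fun i => ⟨(h.1 i).1, (h.1 i).2.le⟩, h.2⟩,
      fun h => ⟨fun i => ⟨(h.1 i).1, (h.1 i).2.lt_of_ne fun h0 => ?_⟩, h.2⟩⟩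
    have hz : B i i = 0 := Complex.ext h0.symm (h.1 i).1
    have hdet := h.2
    rw [det_of_forall_lt_eq_zero hB, Finset.prod_eq_zero (f := fun i => B i i) (Finset.mem_univ i) hz] at hdet
    exact zero_ne_one hdet
  have hc (i j : Fin m) : Continuous fun B : Matrix (Fin m) (Fin m) ℂ => B i j :=
    continuous_id.matrix_elem i j
  rw [this]
  simp only [Set.ofPred_and, Set.ofPred_forall]
  refine IsClosed.inter ?_ (IsClosed.inter ?_ ?_)
  · exact isClosed_iInter fun i => isClosed_iInter fun j => isClosed_iInter fun _ =>
      isClosed_eq (hc i j) continuous_const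
  · exact isClosed_iInter fun i => (isClosed_eq (Complex.continuous_im.comp (hc i i))
      continuous_const).inter (isClosed_le continuous_const (Complex.continuous_re.comp (hc i i)))
  · exact isClosed_eq continuous_id.matrix_det continuous_const

lemma isCompact_specialUnitaryGroup :
    IsCompact (Matrix.specialUnitaryGroup (Fin m) ℂ : Set (Matrix (Fin m) (Fin m) ℂ)) := by
  have hK : IsCompact (Set.univ.pi fun _ : Fin m => Set.univ.pi fun _ : Fin m =>
      Metric.closedBall (0 : ℂ) 1) :=
    isCompact_univ_pi fun _ => isCompact_univ_pi fun _ => isCompact_closedBall 0 1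
  refine IsCompact.of_isClosed_subset (X := Matrix (Fin m) (Fin m) ℂ) hK ?_ ?_
  · have : (Matrix.specialUnitaryGroup (Fin m) ℂ : Set (Matrix (Fin m) (Fin m) ℂ)) =
        {U | U * star U = 1} ∩ {U | U.det = 1} := by
      ext U
      simp only [SetLike.mem_coe, Matrix.mem_specialUnitaryGroup_iff, Matrix.mem_unitaryGroup_iff]
      rfl
    rw [this]
    refine IsClosed.inter (isClosed_eq ?_ continuous_const)
      (isClosed_eq continuous_id.matrix_det continuous_const)
    exact continuous_id.mul continuous_id.matrix_conjTranspose
  · intro U hU i _ j _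
    rw [mem_closedBall_zero_iff]
    exact entry_norm_bound_of_unitary (Matrix.mem_specialUnitaryGroup_iff.1 hU).1 i j

instance compactSpace_specialUnitaryGroup : CompactSpace (Matrix.specialUnitaryGroup (Fin m) ℂ) :=
  isCompact_iff_compactSpace.1 isCompact_specialUnitaryGroup

/-- The multiplication map of the Iwasawa decomposition `SU_m × Sol_m → SL_m`. -/
def iwasawaMul (m : ℕ) (p : Matrix.specialUnitaryGroup (Fin m) ℂ × iwasawaSol m) :
    Matrix (Fin m) (Fin m) ℂ :=
  p.1.1 * p.2.1

lemma star_mul_self_of_mem {U : Matrix (Fin m) (Fin m) ℂ}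
    (hU : U ∈ Matrix.specialUnitaryGroup (Fin m) ℂ) : star U * U = 1 :=
  Matrix.mem_unitaryGroup_iff'.1 (Matrix.mem_specialUnitaryGroup_iff.1 hU).1

lemma mul_star_self_of_mem {U : Matrix (Fin m) (Fin m) ℂ}
    (hU : U ∈ Matrix.specialUnitaryGroup (Fin m) ℂ) : U * star U = 1 :=
  Matrix.mem_unitaryGroup_iff.1 (Matrix.mem_specialUnitaryGroup_iff.1 hU).1

/-- If `V B = B'` with `B` and `B'` in `Sol_m`, then `V` is upper triangular. -/
lemma apply_eq_zero_of_mul_eq_of_mem_iwasawaSol {V B B' : Matrix (Fin m) (Fin m) ℂ}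
    (hB : B ∈ iwasawaSol m) (hB' : B' ∈ iwasawaSol m) (h : V * B = B') {i j : Fin m}
    (hij : j < i) : V i j = 0 := by
  rw [mem_iwasawaSol_iff] at hB hB'
  have hu : IsUnit B.det := by
    rw [hB.2.2]
    exact isUnit_one
  have : Invertible B := Matrix.invertibleOfIsUnitDet B hu
  have h1 : (B⁻¹).BlockTriangular id :=
    Matrix.blockTriangular_inv_of_blockTriangular fun i j hij => hB.1 i j hij
  have h2 : B'.BlockTriangular id := fun i j hij => hB'.1 i j hij
  have h3 : V = B' * B⁻¹ := by rw [← h, Matrix.mul_nonsing_inv_cancel_right _ _ hu]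
  rw [h3]
  exact h2.mul h1 hij

lemma iwasawaMul_injective : Function.Injective (iwasawaMul m) := by
  rintro ⟨⟨U, hU⟩, ⟨B, hB⟩⟩ ⟨⟨U', hU'⟩, ⟨B', hB'⟩⟩ h
  replace h : U * B = U' * B' := h
  set V := star U' * U with hV
  have h1 : V * B = B' := by
    rw [hV, mul_assoc, h, ← mul_assoc, star_mul_self_of_mem hU', one_mul]
  have h2 : star V * B' = B := by
    rw [hV, star_mul, star_star, mul_assoc, ← h, ← mul_assoc, star_mul_self_of_mem hU, one_mul]
  have hVmem : V ∈ Matrix.unitaryGroup (Fin m) ℂ :=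
    mul_mem (Unitary.star_mem (Matrix.mem_specialUnitaryGroup_iff.1 hU').1)
      (Matrix.mem_specialUnitaryGroup_iff.1 hU).1
  -- `V` and its inverse `star V` are both upper triangular, so `V` is diagonal
  have hoff {i j : Fin m} (hij : i ≠ j) : V i j = 0 := by
    rcases lt_or_gt_of_ne hij with hlt | hlt
    · have := apply_eq_zero_of_mul_eq_of_mem_iwasawaSol hB' hB h2 hlt
      rwa [Matrix.star_apply, star_eq_zero] at this
    · exact apply_eq_zero_of_mul_eq_of_mem_iwasawaSol hB hB' h1 hlt
  have hdiag (i : Fin m) : V i i = 1 := by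
    have h3 : V i i * B i i = B' i i := by
      rw [← h1, Matrix.mul_apply, Finset.sum_eq_single i]
      · intro j _ hj
        rw [hoff (Ne.symm hj), zero_mul]
      · simp
    have hnorm := row_norm_of_mem_unitaryGroup hVmem i
    rw [Finset.sum_eq_single i (fun j _ hj => by rw [hoff (Ne.symm hj)]; simp) (by simp)] at hnorm
    have hb := (mem_iwasawaSol_iff.1 hB).2.1 i
    have hb' := (mem_iwasawaSol_iff.1 hB').2.1 i
    have hr : B i i = ((B i i).re : ℂ) := Complex.ext rfl hb.1
    have hr' : B' i i = ((B' i i).re : ℂ) := Complex.ext rfl hb'.1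
    have h4 : (B i i).re = (B' i i).re := by
      have h5 := congrArg norm h3
      rw [norm_mul, (pow_eq_one_iff_of_nonneg (norm_nonneg _) two_ne_zero).1 hnorm,
        one_mul, hr, hr', Complex.norm_real, Complex.norm_real, Real.norm_of_nonneg hb.2.le,
        Real.norm_of_nonneg hb'.2.le] at h5
      exact h5
    have hne : B i i ≠ 0 := by
      rw [hr]
      exact Complex.ofReal_ne_zero.2 hb.2.ne'
    rw [hr', ← h4, ← hr] at h3
    exact mul_right_cancel₀ hne (h3.trans (one_mul _).symm)
  have hV1 : V = 1 := by
    ext i j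
    by_cases hij : i = j
    · rw [hij, hdiag, Matrix.one_apply_eq]
    · rw [hoff hij, Matrix.one_apply_ne hij]
  have hBB : B = B' := by rw [← h1, hV1, one_mul]
  have hUU : U = U' := by
    calc U = U' * (star U' * U) := by rw [← mul_assoc, mul_star_self_of_mem hU', one_mul]
      _ = U' := by rw [← hV, hV1, mul_one]
  simp only [hBB, hUU]

/-- As `SU_m` is compact and `Sol_m` closed, multiplication is a closed map: it is the restriction
to a closed set of the shear `(U, M) ↦ (U, U M)` followed by a projection along `SU_m`. -/
lemma isClosedEmbedding_iwasawaMul : IsClosedEmbedding (iwasawaMul m) := by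
  have hcont : Continuous (iwasawaMul m) := by
    unfold iwasawaMul
    fun_prop
  refine IsClosedEmbedding.of_continuous_injective_isClosedMap hcont iwasawaMul_injective ?_
  let shear : (Matrix.specialUnitaryGroup (Fin m) ℂ × Matrix (Fin m) (Fin m) ℂ) ≃ₜ
      (Matrix.specialUnitaryGroup (Fin m) ℂ × Matrix (Fin m) (Fin m) ℂ) :=
    { toFun := fun p => (p.1, p.1.1 * p.2)
      invFun := fun p => (p.1, star p.1.1 * p.2)
      left_inv := fun p => Prod.ext rfl (by
        simp only
        rw [← mul_assoc, star_mul_self_of_mem p.1.2, one_mul])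
      right_inv := fun p => Prod.ext rfl (by
        simp only
        rw [← mul_assoc, mul_star_self_of_mem p.1.2, one_mul])
      continuous_toFun := by fun_prop
      continuous_invFun := continuous_fst.prodMk
        ((continuous_subtype_val.comp continuous_fst).matrix_conjTranspose.mul continuous_snd) }
  have h : iwasawaMul m = Prod.snd ∘ shear ∘ Prod.map id Subtype.val := rfl
  rw [h]
  exact isClosedMap_snd_of_compactSpace.comp (shear.isClosedMap.comp
    (IsClosedEmbedding.id.prodMap isClosed_iwasawaSol.isClosedEmbedding_subtypeVal).isClosedMap)

/-- Every matrix is the product of a unitary and an upper triangular matrix, by the Gram-Schmidt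
process applied to its columns. -/
lemma exists_unitary_mul_triangular (g : Matrix (Fin m) (Fin m) ℂ) :
    ∃ U ∈ Matrix.unitaryGroup (Fin m) ℂ, ∃ T : Matrix (Fin m) (Fin m) ℂ,
      (∀ i j, j < i → T i j = 0) ∧ U * T = g := by
  let f : Fin m → EuclideanSpace ℂ (Fin m) := fun j => WithLp.toLp 2 fun i => g i j
  let b := InnerProductSpace.gramSchmidtOrthonormalBasis (𝕜 := ℂ) (by simp) f
  let U : Matrix (Fin m) (Fin m) ℂ := Matrix.of fun i j => b j i
  have hinner (i : Fin m) (v : EuclideanSpace ℂ (Fin m)) :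
      inner ℂ (b i) v = ∑ l, star (U l i) * v l := by
    rw [EuclideanSpace.inner_eq_star_dotProduct, dotProduct]
    exact Finset.sum_congr rfl fun l _ => mul_comm _ _
  have hU : U ∈ Matrix.unitaryGroup (Fin m) ℂ := by
    rw [Matrix.mem_unitaryGroup_iff']
    ext i j
    rw [Matrix.mul_apply, Matrix.one_apply, ← orthonormal_iff_ite.1 b.orthonormal i j, hinner]
    rfl
  refine ⟨U, hU, star U * g, fun i j hij => ?_, ?_⟩
  · rw [← InnerProductSpace.gramSchmidtOrthonormalBasis_inv_triangular (𝕜 := ℂ) (by simp) f hij]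
    exact (hinner i (f j)).symm
  · rw [← mul_assoc, Matrix.mem_unitaryGroup_iff.1 hU, one_mul]

lemma range_iwasawaMul : Set.range (iwasawaMul m) = globalMilnorFiber m := by
  ext g
  constructor
  · rintro ⟨⟨⟨U, hU⟩, ⟨B, hB⟩⟩, rfl⟩
    change (U * B).det = 1
    rw [Matrix.det_mul, (Matrix.mem_specialUnitaryGroup_iff.1 hU).2, (mem_iwasawaSol_iff.1 hB).2.2,
      one_mul]
  · intro hg
    replace hg : g.det = 1 := hg
    obtain ⟨U, hU, T, hT, rfl⟩ := exists_unitary_mul_triangular g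
    rw [Matrix.det_mul] at hg
    have hT0 (i : Fin m) : T i i ≠ 0 := by
      intro h0
      rw [det_of_forall_lt_eq_zero hT, Finset.prod_eq_zero (f := fun i => T i i)
        (Finset.mem_univ i) h0, mul_zero] at hg
      exact zero_ne_one hg
    have hTn (i : Fin m) : (‖T i i‖ : ℂ) ≠ 0 :=
      Complex.ofReal_ne_zero.2 (norm_ne_zero_iff.2 (hT0 i))
    have hTsq (i : Fin m) : T i i * star (T i i) = (‖T i i‖ : ℂ) ^ 2 := by
      rw [Complex.star_def, Complex.mul_conj, Complex.normSq_eq_norm_sq]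
      push_cast
      rfl
    -- the phases of the diagonal of `T` are moved to the unitary factor
    let D : Matrix (Fin m) (Fin m) ℂ := Matrix.diagonal fun i => T i i / ‖T i i‖
    have hDstar : star D = Matrix.diagonal fun i => star (T i i) / ‖T i i‖ := by
      rw [Matrix.star_eq_conjTranspose, Matrix.diagonal_conjTranspose]
      congr 1
      ext i
      simp
    have hDD : D * star D = 1 := by
      rw [hDstar, Matrix.diagonal_mul_diagonal, ← Matrix.diagonal_one]
      congr 1
      ext i
      rw [div_mul_div_comm, hTsq, ← pow_two, div_self (pow_ne_zero 2 (hTn i))]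
    have hUD : U * D ∈ Matrix.unitaryGroup (Fin m) ℂ :=
      mul_mem hU (Matrix.mem_unitaryGroup_iff.2 hDD)
    have hprod : U * D * (star D * T) = U * T := by
      rw [mul_assoc, ← mul_assoc D, hDD, one_mul]
    have hupper (i j : Fin m) (hij : j < i) : (star D * T) i j = 0 := by
      rw [hDstar, Matrix.diagonal_mul, hT i j hij, mul_zero]
    have hBdiag (i : Fin m) : (star D * T) i i = (‖T i i‖ : ℂ) := by
      rw [hDstar, Matrix.diagonal_mul, div_mul_eq_mul_div, mul_comm, hTsq, pow_two,
        mul_div_cancel_right₀ _ (hTn i)]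
    have hBdet : (star D * T).det = ((∏ i, ‖T i i‖ : ℝ) : ℂ) := by
      rw [det_of_forall_lt_eq_zero hupper]
      simp only [hBdiag]
      push_cast
      rfl
    have hdet : (U * D).det * (star D * T).det = 1 := by
      rw [← Matrix.det_mul, hprod, Matrix.det_mul, hg]
    have hBdet1 : (star D * T).det = 1 := by
      have h1 := congrArg norm hdet
      have h2 : ‖(U * D).det‖ = 1 := CStarRing.norm_of_mem_unitary (Matrix.det_of_mem_unitary hUD)
      rw [norm_mul, h2, one_mul, hBdet, Complex.norm_real,
        Real.norm_of_nonneg (Finset.prod_nonneg fun i _ => norm_nonneg _), norm_one] at h1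
      rw [hBdet, h1, Complex.ofReal_one]
    have hUdet : (U * D).det = 1 := by rwa [hBdet1, mul_one] at hdet
    refine ⟨⟨⟨U * D, Matrix.mem_specialUnitaryGroup_iff.2 ⟨hUD, hUdet⟩⟩, ⟨star D * T,
      mem_iwasawaSol_iff.2 ⟨hupper, fun i => ?_, hBdet1⟩⟩⟩, hprod⟩
    rw [hBdiag]
    exact ⟨Complex.ofReal_im _, by
      rw [Complex.ofReal_re]
      exact norm_pos_iff.2 (hT0 i)⟩

end Iwasawa

/-! ### Coordinates on the cells -/

section Coordinates

open Topology

/-- The logistic coordinate on the open unit interval. -/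
def unitIntervalHomeomorph : Set.Ioo (0 : ℝ) 1 ≃ₜ ℝ where
  toFun t := Real.log (t / (1 - t))
  invFun s := ⟨Real.exp s / (1 + Real.exp s), by
    have := Real.exp_pos s
    constructor
    · positivity
    · rw [div_lt_one (by positivity)]
      linarith⟩
  left_inv := by
    rintro ⟨t, h0, h1⟩
    have h2 : 0 < 1 - t := by linarith
    refine Subtype.ext ?_
    simp only
    rw [Real.exp_log (div_pos h0 h2)]
    field_simp
    ring
  right_inv := by
    intro s
    have := Real.exp_pos s
    have h : Real.exp s / (1 + Real.exp s) / (1 - Real.exp s / (1 + Real.exp s)) = Real.exp s := by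
      field_simp
      ring
    simp only [h, Real.log_exp]
  continuous_toFun := by
    refine Continuous.log (continuous_subtype_val.div
      (continuous_const.sub continuous_subtype_val) fun t => ?_) fun t => ?_
    · exact (sub_pos.2 t.2.2).ne'
    · exact (div_pos t.2.1 (sub_pos.2 t.2.2)).ne'
  continuous_invFun := by
    refine Continuous.subtype_mk (Real.continuous_exp.div
      (continuous_const.add Real.continuous_exp) fun s => ?_) _
    exact (add_pos one_pos (Real.exp_pos s)).ne'

variable {n : ℕ}

/-- The vector `(y_1, …, y_j, 1, 0, …, 0)`, with the entry `1` in position `j : Fin n`. -/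
def affineVector (j : Fin n) (y : Fin j → ℂ) : EuclideanSpace ℂ (Fin n) :=
  WithLp.toLp 2 fun i => if h : i.val < j.val then y ⟨i, h⟩ else if i = j then 1 else 0

lemma affineVector_self (j : Fin n) (y : Fin j → ℂ) : affineVector j y j = 1 := by
  simp [affineVector]

lemma affineVector_of_lt {j i : Fin n} (y : Fin j → ℂ) (h : i.val < j.val) :
    affineVector j y i = y ⟨i, h⟩ :=
  dif_pos h

lemma affineVector_of_gt {j i : Fin n} (y : Fin j → ℂ) (h : j.val < i.val) :
    affineVector j y i = 0 := by
  have h1 : ¬ i.val < j.val := by omega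
  have h2 : i ≠ j := fun h3 => by
    rw [h3] at h
    exact lt_irrefl _ h
  exact (dif_neg h1).trans (if_neg h2)

lemma norm_affineVector_pos (j : Fin n) (y : Fin j → ℂ) : 0 < ‖affineVector j y‖ := by
  rw [norm_pos_iff]
  intro h
  have := affineVector_self j y
  rw [h] at this
  simp at this

lemma continuous_affineVector (j : Fin n) : Continuous (affineVector j) := by
  refine (PiLp.continuous_toLp 2 _).comp (continuous_pi fun i => ?_)
  by_cases h : i.val < j.val
  · simp only [h, dite_true]
    exact continuous_apply _
  · simp only [h, dite_false]
    exact continuous_const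

/-- The open hemisphere `x_j > 0` is identified with an affine space by central projection
`x ↦ (x_i / x_j)_{i < j}`. -/
def simpleCellHomeomorph (j : Fin n) : simpleCell n (j.val + 1) ≃ₜ ℝ × (Fin j → ℂ) where
  toFun q := (unitIntervalHomeomorph ⟨q.1.1, q.2.1⟩, fun i => q.1.2 (i.castLE j.2.le) / q.1.2 j)
  invFun a := ⟨((unitIntervalHomeomorph.symm a.1 : ℝ),
    ((‖affineVector j a.2‖⁻¹ : ℝ) : ℂ) • affineVector j a.2), by
    have hpos := norm_affineVector_pos j a.2
    refine ⟨(unitIntervalHomeomorph.symm a.1).2, ?_, fun i hi => ?_, j, rfl, ?_, ?_⟩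
    · rw [norm_smul, Complex.norm_real, norm_inv, norm_norm, inv_mul_cancel₀ hpos.ne']
    · simp only [PiLp.smul_apply]
      rw [affineVector_of_gt _ (by omega), smul_zero]
    · simp only [PiLp.smul_apply]
      rw [affineVector_self, smul_eq_mul, mul_one, Complex.ofReal_im]
    · simp only [PiLp.smul_apply]
      rw [affineVector_self, smul_eq_mul, mul_one, Complex.ofReal_re]
      positivity⟩
  left_inv := by
    rintro ⟨⟨t, x⟩, hq⟩
    obtain ⟨c, hc, hxc⟩ := exists_pos_of_mem_simpleCell hq
    simp only at hxc
    have hc' : (c : ℂ) ≠ 0 := Complex.ofReal_ne_zero.2 hc.ne'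
    have hv : affineVector j (fun i => x (i.castLE j.2.le) / x j) = ((c⁻¹ : ℝ) : ℂ) • x := by
      ext i
      simp only [PiLp.smul_apply, smul_eq_mul]
      rcases lt_trichotomy i.val j.val with h | h | h
      · rw [affineVector_of_lt _ h, hxc, Complex.ofReal_inv, div_eq_inv_mul]
        rfl
      · rw [Fin.ext h, affineVector_self, hxc, Complex.ofReal_inv, inv_mul_cancel₀ hc']
      · have h0 : x i = 0 := hq.2.2.1 i h
        rw [affineVector_of_gt _ h, h0, mul_zero]
    have hx : ‖x‖ = 1 := hq.2.1
    refine Subtype.ext (Prod.ext (by simp) ?_)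
    simp only
    rw [hv, norm_smul, hx, Complex.norm_real, norm_inv, Real.norm_of_nonneg hc.le, mul_one, inv_inv,
      smul_smul, ← Complex.ofReal_mul, mul_inv_cancel₀ hc.ne', Complex.ofReal_one, one_smul]
  right_inv := by
    rintro ⟨s, y⟩
    have hpos := norm_affineVector_pos j y
    have hne : ((‖affineVector j y‖⁻¹ : ℝ) : ℂ) ≠ 0 := Complex.ofReal_ne_zero.2 (inv_pos.2 hpos).ne'
    refine Prod.ext (unitIntervalHomeomorph.apply_symm_apply s) (funext fun i => ?_)
    simp only [PiLp.smul_apply]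
    rw [affineVector_self, affineVector_of_lt (i := i.castLE j.2.le) y i.2, smul_eq_mul,
      smul_eq_mul, mul_one, mul_div_cancel_left₀ _ hne]
    rfl
  continuous_toFun := by
    refine Continuous.prodMk (unitIntervalHomeomorph.continuous.comp (by fun_prop))
      (continuous_pi fun i => Continuous.div (by fun_prop) (by fun_prop) fun q => ?_)
    obtain ⟨c, hc, hqc⟩ := exists_pos_of_mem_simpleCell q.2
    rw [hqc]
    exact Complex.ofReal_ne_zero.2 hc.ne'
  continuous_invFun := by
    refine Continuous.subtype_mk (Continuous.prodMk ?_ ?_) _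
    · exact continuous_subtype_val.comp (unitIntervalHomeomorph.symm.continuous.comp continuous_fst)
    · have h := (continuous_affineVector j).comp (continuous_snd (X := ℝ))
      refine (Complex.continuous_ofReal.comp (h.norm.inv₀ fun a => ?_)).smul h
      exact (norm_affineVector_pos j a.2).ne'

lemma nonempty_simpleCell_homeomorph {r : ℕ} (h1 : 1 ≤ r) (hn : r ≤ n) :
    Nonempty (simpleCell n r ≃ₜ ℝ × (Fin (r - 1) → ℂ)) := by
  obtain ⟨j, rfl⟩ : ∃ j, r = j + 1 := ⟨r - 1, by omega⟩
  exact ⟨simpleCellHomeomorph ⟨j, hn⟩⟩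

/-- The sum of the coordinates, whose kernel is the Lie algebra of `A_m`. -/
def coordSum (m : ℕ) : (Fin m → ℝ) →ₗ[ℝ] ℝ := ∑ i, LinearMap.proj i

lemma coordSum_apply {m : ℕ} (a : Fin m → ℝ) : coordSum m a = ∑ i, a i := by
  simp [coordSum]

/-- The upper triangular matrix with diagonal `exp a` and entries `c` above the diagonal. -/
def solMatrix {m : ℕ} (a : Fin m → ℝ) (c : {p : Fin m × Fin m // p.1 < p.2} → ℂ) :
    Matrix (Fin m) (Fin m) ℂ :=
  Matrix.of fun i j => if h : i < j then c ⟨(i, j), h⟩ else if i = j then (Real.exp (a i) : ℂ) else 0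

lemma solMatrix_of_lt {m : ℕ} (a : Fin m → ℝ) (c : {p : Fin m × Fin m // p.1 < p.2} → ℂ)
    {i j : Fin m} (h : i < j) : solMatrix a c i j = c ⟨(i, j), h⟩ := by
  simp [solMatrix, h]

lemma solMatrix_self {m : ℕ} (a : Fin m → ℝ) (c : {p : Fin m × Fin m // p.1 < p.2} → ℂ)
    (i : Fin m) : solMatrix a c i i = (Real.exp (a i) : ℂ) := by
  simp [solMatrix]

lemma solMatrix_of_gt {m : ℕ} (a : Fin m → ℝ) (c : {p : Fin m × Fin m // p.1 < p.2} → ℂ)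
    {i j : Fin m} (h : j < i) : solMatrix a c i j = 0 := by
  simp [solMatrix, h.not_gt, h.ne']

lemma solMatrix_mem {m : ℕ} {a : Fin m → ℝ} (ha : coordSum m a = 0)
    (c : {p : Fin m × Fin m // p.1 < p.2} → ℂ) : solMatrix a c ∈ iwasawaSol m := by
  rw [mem_iwasawaSol_iff]
  refine ⟨fun i j h => solMatrix_of_gt a c h, fun i => ?_, ?_⟩
  · rw [solMatrix_self]
    exact ⟨Complex.ofReal_im _, by
      rw [Complex.ofReal_re]
      exact Real.exp_pos _⟩
  · rw [det_of_forall_lt_eq_zero fun i j h => solMatrix_of_gt a c h]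
    simp only [solMatrix_self]
    rw [← Complex.ofReal_prod, ← Real.exp_sum, ← coordSum_apply, ha, Real.exp_zero,
      Complex.ofReal_one]

/-- Logarithmic coordinates on the diagonal and linear ones above it. -/
def iwasawaSolHomeomorph (m : ℕ) : iwasawaSol m ≃ₜ
    LinearMap.ker (coordSum m) × ({p : Fin m × Fin m // p.1 < p.2} → ℂ) where
  toFun B := (⟨fun i => Real.log (B.1 i i).re, by
    obtain ⟨hB, hd, hdet⟩ := mem_iwasawaSol_iff.1 B.2
    rw [LinearMap.mem_ker, coordSum_apply, ← Real.log_prod fun i _ => (hd i).2.ne']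
    have h : ((∏ i, (B.1 i i).re : ℝ) : ℂ) = 1 := by
      rw [← hdet, det_of_forall_lt_eq_zero hB, Complex.ofReal_prod]
      exact Finset.prod_congr rfl fun i _ => Complex.ext rfl (hd i).1.symm
    rw [Complex.ofReal_eq_one.1 h, Real.log_one]⟩, fun p => B.1 p.1.1 p.1.2)
  invFun x := ⟨solMatrix x.1.1 x.2, solMatrix_mem x.1.2 x.2⟩
  left_inv := by
    rintro ⟨B, hB⟩
    obtain ⟨hu, hd, -⟩ := mem_iwasawaSol_iff.1 hB
    refine Subtype.ext ?_
    ext i j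
    simp only
    rcases lt_trichotomy i j with h | rfl | h
    · rw [solMatrix_of_lt _ _ h]
    · rw [solMatrix_self, Real.exp_log (hd i).2]
      exact Complex.ext rfl (hd i).1.symm
    · rw [solMatrix_of_gt _ _ h, hu i j h]
  right_inv := by
    rintro ⟨⟨a, ha⟩, c⟩
    refine Prod.ext (Subtype.ext (funext fun i => ?_)) (funext fun p => ?_)
    · simp only
      rw [solMatrix_self, Complex.ofReal_re, Real.log_exp]
    · simp only
      rw [solMatrix_of_lt _ _ p.2]
  continuous_toFun := by
    have hc (i j : Fin m) : Continuous fun B : iwasawaSol m => B.1 i j :=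
      continuous_subtype_val.matrix_elem i j
    refine Continuous.prodMk (Continuous.subtype_mk (continuous_pi fun i => ?_) _)
      (continuous_pi fun p => hc _ _)
    exact (Complex.continuous_re.comp (hc i i)).log
      fun B => ((mem_iwasawaSol_iff.1 B.2).2.1 i).2.ne'
  continuous_invFun := by
    refine Continuous.subtype_mk (continuous_matrix fun i j => ?_) _
    rcases lt_trichotomy i j with h | rfl | h
    · simp only [solMatrix_of_lt _ _ h]
      fun_prop
    · simp only [solMatrix_self]
      exact Complex.continuous_ofReal.comp (Real.continuous_exp.comp
        ((continuous_apply i).comp (continuous_subtype_val.comp continuous_fst)))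
    · simp only [solMatrix_of_gt _ _ h]
      fun_prop

lemma finrank_ker_coordSum {m : ℕ} (hm : 1 ≤ m) :
    Module.finrank ℝ (LinearMap.ker (coordSum m)) = m - 1 := by
  have hsurj : Function.Surjective (coordSum m) := fun x =>
    ⟨Pi.single ⟨0, hm⟩ x, by simp [coordSum_apply]⟩
  have h := LinearMap.finrank_range_add_finrank_ker (coordSum m)
  rw [LinearMap.range_eq_top.2 hsurj, finrank_top, Module.finrank_self,
    Module.finrank_fin_fun] at h
  omega

lemma card_pairs_lt (m : ℕ) : Fintype.card {p : Fin m × Fin m // p.1 < p.2} = m.choose 2 := by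
  rw [Fintype.card_subtype, ← Finset.univ_product_univ, Finset.card_filter, Finset.sum_product_right]
  simp only [← Finset.card_filter, Finset.filter_gt_eq_Iio, Fin.card_Iio]
  rw [Fin.sum_univ_eq_sum_range fun i => i, Finset.sum_range_id, Nat.choose_two_right]

lemma finrank_fun_complex (ι : Type*) [Fintype ι] :
    Module.finrank ℝ (ι → ℂ) = 2 * Fintype.card ι := by
  rw [Module.finrank_pi_fintype]
  simp [Complex.finrank_real_complex, mul_comm]

/-- The product of the parameter cell with `Sol_m` is homeomorphic to a Euclidean space. -/
lemma nonempty_paramCell_prod_homeomorph {m : ℕ} (hm : 1 ≤ m) (s : SchubertSymbol m) :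
    Nonempty ((s.paramCell × iwasawaSol m) ≃ₜ EuclideanSpace ℝ (Fin (milnorCellDim s))) := by
  have φ (i : Fin s.length) :=
    (nonempty_simpleCell_homeomorph (s.one_lt i).le (s.le i)).some
  let e : s.paramCell ≃ₜ ∀ i, simpleCell m (s.entry i) :=
    { toEquiv := Equiv.Set.univPi fun i => simpleCell m (s.entry i)
      continuous_toFun := continuous_pi fun i => Continuous.subtype_mk
        ((continuous_apply i).comp continuous_subtype_val) _
      continuous_invFun := Continuous.subtype_mk (continuous_pi fun i =>
        continuous_subtype_val.comp (continuous_apply i)) _ }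
  let V := (∀ i, ℝ × (Fin (s.entry i - 1) → ℂ)) ×
    (LinearMap.ker (coordSum m) × ({p : Fin m × Fin m // p.1 < p.2} → ℂ))
  have hV : Module.finrank ℝ V = Module.finrank ℝ (EuclideanSpace ℝ (Fin (milnorCellDim s))) := by
    simp only [V]
    rw [finrank_euclideanSpace_fin, Module.finrank_prod, Module.finrank_prod,
      Module.finrank_pi_fintype, finrank_ker_coordSum hm, finrank_fun_complex, card_pairs_lt,
      milnorCellDim, SchubertSymbol.dim]
    congr 1
    · refine Finset.sum_congr rfl fun i _ => ?_
      rw [Module.finrank_prod, Module.finrank_self, finrank_fun_complex, Fintype.card_fin]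
      have := s.one_lt i
      omega
    · omega
  exact ⟨((e.trans (Homeomorph.piCongrRight φ)).prodCongr (iwasawaSolHomeomorph m)).trans
    (ContinuousLinearEquiv.ofFinrankEq hV).toHomeomorph⟩

end Coordinates

/-! ### The cell decomposition of the Milnor fiber -/

section Main

open Topology

variable {m : ℕ}

/-- The parametrization of a Schubert cell of the Milnor fiber. -/
def milnorParam (s : SchubertSymbol m) (p : s.paramCell × iwasawaSol m) :
    Matrix (Fin m) (Fin m) ℂ :=
  s.psi p.1.1 * (p.2 : Matrix (Fin m) (Fin m) ℂ)

lemma range_milnorParam (s : SchubertSymbol m) :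
    Set.range (milnorParam s) = milnorSchubertCell s := by
  ext g
  constructor
  · rintro ⟨⟨⟨p, hp⟩, ⟨B, hB⟩⟩, rfl⟩
    exact ⟨_, ⟨p, hp, rfl⟩, B, hB, rfl⟩
  · rintro ⟨_, ⟨p, hp, rfl⟩, B, hB, rfl⟩
    exact ⟨⟨⟨p, hp⟩, ⟨B, hB⟩⟩, rfl⟩

lemma isEmbedding_milnorParam (hm : 1 ≤ m) (s : SchubertSymbol m) :
    IsEmbedding (milnorParam s) := by
  have h : IsEmbedding fun p : s.paramCell =>
      (⟨s.psi p.1, s.schubertCell_subset hm ⟨p.1, p.2, rfl⟩⟩ :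
        Matrix.specialUnitaryGroup (Fin m) ℂ) :=
    (s.isEmbedding_psi hm).codRestrict _ _
  exact isClosedEmbedding_iwasawaMul.isEmbedding.comp (h.prodMap IsEmbedding.id)

lemma milnorSchubertCell_eq_image (hm : 1 ≤ m) (s : SchubertSymbol m) :
    milnorSchubertCell s = iwasawaMul m '' {p | p.1.1 ∈ s.schubertCell} := by
  ext g
  constructor
  · rintro ⟨U, hU, B, hB, rfl⟩
    exact ⟨(⟨U, s.schubertCell_subset hm hU⟩, ⟨B, hB⟩), hU, rfl⟩
  · rintro ⟨⟨⟨U, hU⟩, ⟨B, hB⟩⟩, h, rfl⟩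
    exact ⟨U, h, B, hB, rfl⟩

lemma iUnion_milnorSchubertCell (hm : 1 ≤ m) :
    (⋃ s : SchubertSymbol m, milnorSchubertCell s) = globalMilnorFiber m := by
  rw [← range_iwasawaMul]
  refine subset_antisymm (Set.iUnion_subset fun s => ?_) ?_
  · rw [milnorSchubertCell_eq_image hm]
    exact Set.image_subset_range _ _
  · rintro _ ⟨p, rfl⟩
    obtain ⟨s, hs⟩ := exists_mem_schubertCell hm p.1.2
    refine Set.mem_iUnion.2 ⟨s, ?_⟩
    rw [milnorSchubertCell_eq_image hm]
    exact ⟨p, hs, rfl⟩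

lemma pairwise_disjoint_milnorSchubertCell (hm : 1 ≤ m) :
    Pairwise fun s s' : SchubertSymbol m =>
      Disjoint (milnorSchubertCell s) (milnorSchubertCell s') := by
  intro s s' hne
  rw [milnorSchubertCell_eq_image hm, milnorSchubertCell_eq_image hm,
    Set.disjoint_image_iff iwasawaMul_injective, Set.disjoint_left]
  intro p hp hp'
  exact hne (SchubertSymbol.eq_of_tailCount_eq fun r hr _ =>
    (s.rank_lowerDefect hm hp hr).symm.trans (s'.rank_lowerDefect hm hp' hr))

lemma frontier_milnorSchubertCell (hm : 1 ≤ m) (s : SchubertSymbol m) :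
    closure (milnorSchubertCell s) \ milnorSchubertCell s ⊆
      ⋃ s' : {s' : SchubertSymbol m // milnorCellDim s' < milnorCellDim s},
        milnorSchubertCell s'.1 := by
  rintro g ⟨hg, hgs⟩
  rw [milnorSchubertCell_eq_image hm, isClosedEmbedding_iwasawaMul.closure_image_eq] at hg
  obtain ⟨p, hp, rfl⟩ := hg
  obtain ⟨s', hs'⟩ := exists_mem_schubertCell hm p.1.2
  have hmem : iwasawaMul m p ∈ milnorSchubertCell s' := by
    rw [milnorSchubertCell_eq_image hm]
    exact ⟨p, hs', rfl⟩
  have hcl : p.1.1 ∈ closure s.schubertCell :=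
    map_mem_closure (f := fun p : Matrix.specialUnitaryGroup (Fin m) ℂ × iwasawaSol m => p.1.1)
      (by fun_prop) hp fun q hq => hq
  have hne : s' ≠ s := by
    rintro rfl
    exact hgs hmem
  have hdim : s'.dim < s.dim := SchubertSymbol.dim_lt_of_tailCount_le
    (fun r hr => SchubertSymbol.tailCount_le_of_mem_closure hm hcl hs' hr) hne
  exact Set.mem_iUnion.2 ⟨⟨s', Nat.add_lt_add_right hdim _⟩, hmem⟩

lemma range_coe_specialLinearGroup (m : ℕ) :
    Set.range (fun g : Matrix.SpecialLinearGroup (Fin m) ℂ => (g : Matrix (Fin m) (Fin m) ℂ)) =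
      globalMilnorFiber m :=
  Subtype.range_coe

lemma isClosedEmbedding_coe_specialLinearGroup (m : ℕ) : IsClosedEmbedding
    (fun g : Matrix.SpecialLinearGroup (Fin m) ℂ => (g : Matrix (Fin m) (Fin m) ℂ)) := by
  refine ⟨IsEmbedding.subtypeVal, ?_⟩
  rw [range_coe_specialLinearGroup]
  exact isClosed_singleton.preimage continuous_id.matrix_det

end Main

end

theorem theorem5p13 (m : ℕ) (hm : 1 ≤ m) :
    -- the global Milnor fiber is `SL_m(ℂ)`
    (Topology.IsClosedEmbedding
        (fun g : Matrix.SpecialLinearGroup (Fin m) ℂ => (g : Matrix (Fin m) (Fin m) ℂ)) ∧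
      Set.range (fun g : Matrix.SpecialLinearGroup (Fin m) ℂ => (g : Matrix (Fin m) (Fin m) ℂ)) =
        globalMilnorFiber m) ∧
    -- it is the disjoint union of the sets `S_𝐦 · Sol_m`
    (⋃ s : SchubertSymbol m, milnorSchubertCell s) = globalMilnorFiber m ∧
    Pairwise (fun s s' : SchubertSymbol m =>
      Disjoint (milnorSchubertCell s) (milnorSchubertCell s')) ∧
    -- the `S_𝐦` lie in `SU_m`
    (∀ s : SchubertSymbol m,
      s.schubertCell ⊆ (Matrix.specialUnitaryGroup (Fin m) ℂ : Set (Matrix (Fin m) (Fin m) ℂ))) ∧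
    -- each `S_𝐦 · Sol_m` is an open cell, parametrized by `E_𝐦 × Sol_m`
    (∀ s : SchubertSymbol m,
      Topology.IsEmbedding
        (fun p : s.paramCell × iwasawaSol m =>
          s.psi p.1.1 * (p.2 : Matrix (Fin m) (Fin m) ℂ)) ∧
      Set.range
        (fun p : s.paramCell × iwasawaSol m =>
          s.psi p.1.1 * (p.2 : Matrix (Fin m) (Fin m) ℂ)) = milnorSchubertCell s ∧
      Nonempty (milnorSchubertCell s ≃ₜ EuclideanSpace ℝ (Fin (milnorCellDim s)))) ∧
    -- the frontier of each cell lies in the union of the cells of smaller dimension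
    (∀ s : SchubertSymbol m,
      closure (milnorSchubertCell s) \ milnorSchubertCell s ⊆
        ⋃ s' : {s' : SchubertSymbol m // milnorCellDim s' < milnorCellDim s},
          milnorSchubertCell s'.1) := by
  refine ⟨⟨isClosedEmbedding_coe_specialLinearGroup m, range_coe_specialLinearGroup m⟩,
    iUnion_milnorSchubertCell hm, pairwise_disjoint_milnorSchubertCell hm,
    fun s => s.schubertCell_subset hm, fun s => ?_, frontier_milnorSchubertCell hm⟩
  have hs := isEmbedding_milnorParam hm s
  refine ⟨hs, range_milnorParam s, ?_⟩
  obtain ⟨φ⟩ := nonempty_paramCell_prod_homeomorph hm s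
  exact ⟨(Homeomorph.setCongr (range_milnorParam s)).symm.trans (hs.toHomeomorph.symm.trans φ)⟩
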